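/- **Setting.** Let $d \in \mathbb{N}$ and let $\sigma : \mathbb{R} \to \mathbb{R}$ be a Lipschitz function that is not a polynomial. Let $\mathcal{K} \subset \mathbb{R}^d$ be compact and let $\mathcal{D}$ be a probability measure on $\mathbb{R}^d$ with $\mathcal{D}(\mathbb{R}^d \setminus \mathcal{K}) = 0$. The bias of the network is carried by the input: there is $v \in \mathbb{R}^d$ with $v \cdot x = 1$ for all $x \in \mathcal{K}$ (for instance, one coordinate is equal to a fixed non-zero constant on $\mathcal{K}$). Let $f^* : \mathbb{R}^d \to \mathbb{R}$ be continuous. For $m \in \mathbb{N}$ let $\Theta^{(m)} = \mathbb{R}^{m \times d} \times \mathbb{R}^m$ with the Euclidean norm, and for $\theta = (w,a) \in \Theta^{(m)}$ let $$F^{(m)}(\theta)(x) = \sum_{i=1}^m a_i\, \sigma(w_i \cdot x), \qquad \mathcal{L}(\theta) = \mathcal{L}^{(m)}(\theta) = \mathbb{E}_{x \sim \mathcal{D}}\big[(F^{(m)}(\theta)(x) - f^*(x))^2\big].$$ Let $\mathcal{I}_m$ be the law on $\Theta^{(m)}$ under which all coordinates are independent centred Gaussians, the $w_{i,j}$ with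 variance $1$ and the $a_k$ with variance $1/m$ (standard deviation $1/\sqrt{m}$). Write $(u)_+ = \max(0,u)$ and $\mathcal{B}(\theta_0,R) = \{\theta : \|\theta - \theta_0\| \le R\}$. A gradient flow of $\mathcal{L}$ is a curve $\theta : \mathbb{R}_+ \to \Theta^{(m)}$, absolutely continuous on compact intervals, such that for almost every $t$ the function $\mathcal{L}$ is differentiable at $\theta_t$ and $\partial_t \theta_t = -\nabla \mathcal{L}(\theta_t)$. **Proposition.** Let $\delta \in (0,1)$. (0) If $\sigma$ is differentiable, then $\mathcal{L}^{(m)}$ is differentiable on $\Theta^{(m)}$ for every $m$. (a) For every $\varepsilon > 0$ there is $c > 0$ such that for every $R > 0$ there is $m_0 \in \mathbb{N}$ such that for every $m \ge m_0$, with probability at least $1-\delta$ over $\theta_0 \sim \mathcal{I}_m$, every $\theta \in \mathcal{B}(\theta_0,R)$ at which $\mathcal{L}$ is differentiable (by (0), every $\theta \in \mathcal{B}(\theta_0,R)$ if $\sigma$ is differentiable) satisfies $$\|\nabla \mathcal{L}(\theta)\|^2 \ \ge\ \frac{(\mathcal{L}(\theta) - \varepsilon)_+^2}{(\|\theta - \theta_0\|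 + c)^2}.$$ (b) For every $\varepsilon_0 > 0$ there are $\kappa > 0$ and $m_0 \in \mathbb{N}$ such that for every $m \ge m_0$, with probability at least $1-\delta$ over $\theta_0 \sim \mathcal{I}_m$, every gradient flow $\theta : \mathbb{R}_+ \to \Theta^{(m)}$ of $\mathcal{L}$ with $\theta(0) = \theta_0$ satisfies $$\forall t \ge 0, \qquad \mathcal{L}(\theta_t) \ \le\ \varepsilon_0 + \frac{1}{\sqrt[3]{\mathcal{L}(\theta_0)^{-3} + \kappa t}},$$ where for $\mathcal{L}(\theta_0) = 0$ the term $\mathcal{L}(\theta_0)^{-3}$ and, at $t = 0$, the whole fraction are read as $0$. -/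

import Mathlib

open MeasureTheory ProbabilityTheory
open scoped NNReal ENNReal Gradient

noncomputable section

namespace TwoLayer

/-- Input space `ℝ^d` with its Euclidean structure. -/
abbrev Input (d : ℕ) : Type := EuclideanSpace ℝ (Fin d)

/-- Parameter space `ℝ^{m × d} × ℝ^m` with the Euclidean norm of all the coordinates: the coordinate
`Sum.inl (i, j)` is the weight `w_{i,j}`, the coordinate `Sum.inr i` is the output weight `a_i`. -/
abbrev Param (m d : ℕ) : Type := EuclideanSpace ℝ ((Fin m × Fin d) ⊕ Fin m)

/-- The weight vector `w_i ∈ ℝ^d` of the `i`-th neuron. -/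
def Param.w {m d : ℕ} (θ : Param m d) (i : Fin m) : Input d :=
  WithLp.toLp 2 fun j => θ (Sum.inl (i, j))

/-- The output weight `a_i` of the `i`-th neuron. -/
def Param.a {m d : ℕ} (θ : Param m d) (i : Fin m) : ℝ :=
  θ (Sum.inr i)

/-- The network map `F(w, a) : x ↦ ∑ i, a_i σ(w_i · x)`. -/
def network (σ : ℝ → ℝ) {m d : ℕ} (θ : Param m d) (x : Input d) : ℝ :=
  ∑ i : Fin m, θ.a i * σ (inner ℝ (θ.w i) x)

/-- The squared seminorm `‖g‖_D² = E_{x ∼ D}[g(x)²]`. -/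
def sqSeminorm {d : ℕ} (D : Measure (Input d)) (g : Input d → ℝ) : ℝ :=
  ∫ x, g x ^ 2 ∂D

/-- The quadratic loss `L(θ) = ‖F(θ) - f‖_D²`. -/
def loss (σ : ℝ → ℝ) {d : ℕ} (D : Measure (Input d)) (f : Input d → ℝ) (m : ℕ)
    (θ : Param m d) : ℝ :=
  sqSeminorm D fun x => network σ θ x - f x

/-- The Gaussian initialization: independent centred coordinates, `w_{i,j}` with variance `1` and
`a_k` with standard deviation `1 / √m`, i.e. variance `1 / m`. -/
def initMeasure (m d : ℕ) : Measure (Param m d) :=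
  (Measure.pi fun k : (Fin m × Fin d) ⊕ Fin m =>
    Sum.elim (fun _ => gaussianReal 0 1) (fun _ => gaussianReal 0 (1 / (m : ℝ≥0))) k).map
      (WithLp.toLp 2)

/-- `P` holds with probability at least `p` under `μ`: it holds on some measurable event of
probability at least `p` (so that no measurability of `P` itself is presupposed). -/
def WithProbAtLeast {Ω : Type*} [MeasurableSpace Ω] (μ : Measure Ω) (p : ℝ) (P : Ω → Prop) : Prop :=
  ∃ E : Set Ω, MeasurableSet E ∧ ENNReal.ofReal p ≤ μ E ∧ ∀ ω ∈ E, P ω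

/-- `θ : ℝ₊ → Θ` is a gradient flow of `L`: it is absolutely continuous on every compact interval
`[0, T]`, and for almost every time `L` is differentiable at `θ_t` and `∂_t θ = -∇L(θ)`.
Values of `θ` at negative times play no role. -/
def IsGradientFlow {Θ : Type*} [NormedAddCommGroup Θ] [InnerProductSpace ℝ Θ] [CompleteSpace Θ]
    (L : Θ → ℝ) (θ : ℝ → Θ) : Prop :=
  (∀ T : ℝ, 0 ≤ T → AbsolutelyContinuousOnInterval θ 0 T) ∧
    ∀ᵐ t : ℝ, 0 < t → DifferentiableAt ℝ L (θ t) ∧ HasDerivAt θ (-∇ L (θ t)) t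

end TwoLayer

end

/-! For fixed hidden weights the network is linear in the output weights, so the loss is convex in
them. Hence any `b` gives `L(w, a) - L(w, b) ≤ ‖∇L(w, a)‖ ‖b - a‖` (`loss_sub_loss_withA_le`), and
(a) follows once some `b` with `‖b‖ ≤ 1` makes `L(w, b) ≤ ε` for every `w` in the ball.

Such a `b` is sampled from an infinitely wide network. By density of finite networks in `L²(D)`, the
target is close to `x ↦ ∫ g(w) σ(w · x)` with `g` bounded and the integral taken under the Gaussian
law (`exists_density_approx`). Put `b i = g(w_i) / m` at the initial weights: a variance bound shows
that this average is close to the integral with high probability, and since `b i = O(1/m)`, moving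
the hidden weights by `R` changes the network only by `O(R/√m)`. Thus `R` affects the width
threshold but not `c` (`exists_gradient_lower_bound`).

Density is proved by duality. If `h` annihilates every `σ(w · x)`, it annihilates the same
expressions for mollifications of `σ`, because the bias direction `v` turns translations of `σ` into
changes of `w`. Differentiating at points where derivatives of the mollification do not vanish kills
all moments of `h`, hence its Fourier transform, hence `h`.

For (b), put `y = L - ε`, `r = dist(θ_t, θ_0) + c` and `G = ‖∇L‖`. From `y ≤ G r`, `y' = -G²` and
`r' ≤ G`, the product `y r` does not increase, so it stays below `c M`, where `M` bounds the initial
loss. While `y ≥ ε` this confines the flow to radius `c M / ε`, known before `m` is chosen. It also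
gives `y² ≤ G y r ≤ G c M`, so `y' ≤ -y⁴ / (c M)²`, and `y⁻³` grows at least linearly
(`IsGradientFlow.loss_le`). -/

/-! ### Absolutely continuous functions and almost-everywhere derivatives. -/

section AbsolutelyContinuous

theorem LipschitzOnWith.comp_absolutelyContinuousOnInterval {X Y : Type*} [PseudoMetricSpace X]
    [PseudoMetricSpace Y] {g : X → Y} {f : ℝ → X} {K : ℝ≥0} {s : Set X} {a b : ℝ}
    (hg : LipschitzOnWith K g s) (hf : AbsolutelyContinuousOnInterval f a b)
    (hs : Set.MapsTo f (Set.uIcc a b) s) :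
    AbsolutelyContinuousOnInterval (g ∘ f) a b := by
  rw [absolutelyContinuousOnInterval_iff] at hf ⊢
  intro ε hε
  obtain ⟨δ, hδ, h⟩ := hf (ε / (K + 1)) (by positivity)
  refine ⟨δ, hδ, fun E hE hlt => ?_⟩
  have h1 := h E hE hlt
  have hmem : ∀ i ∈ Finset.range E.1, (E.2 i).1 ∈ Set.uIcc a b ∧ (E.2 i).2 ∈ Set.uIcc a b := by
    intro i hi
    exact hE.1 i hi
  calc ∑ i ∈ Finset.range E.1, dist ((g ∘ f) (E.2 i).1) ((g ∘ f) (E.2 i).2)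
      ≤ ∑ i ∈ Finset.range E.1, K * dist (f (E.2 i).1) (f (E.2 i).2) :=
        Finset.sum_le_sum fun i hi => hg.dist_le_mul _ (hs (hmem i hi).1) _ (hs (hmem i hi).2)
    _ = K * ∑ i ∈ Finset.range E.1, dist (f (E.2 i).1) (f (E.2 i).2) := by rw [Finset.mul_sum]
    _ ≤ (K + 1) * ∑ i ∈ Finset.range E.1, dist (f (E.2 i).1) (f (E.2 i).2) := by
        gcongr
        simp
    _ < (K + 1) * (ε / (K + 1)) := by gcongr
    _ = ε := by field_simp

/-- The fundamental theorem of calculus for absolutely continuous functions. Continuity alone would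
not do, as the Cantor function shows. -/
theorem AbsolutelyContinuousOnInterval.le_of_ae_hasDerivAt_nonpos {f : ℝ → ℝ} {a b : ℝ}
    (hab : a ≤ b) (hf : AbsolutelyContinuousOnInterval f a b)
    (h : ∀ᵐ t : ℝ, t ∈ Set.Ioo a b → ∃ f', HasDerivAt f f' t ∧ f' ≤ 0) : f b ≤ f a := by
  have h1 := hf.integral_deriv_eq_sub
  have h2 : ∫ x in a..b, deriv f x ≤ 0 := by
    rw [intervalIntegral.integral_of_le hab, integral_Ioc_eq_integral_Ioo]
    refine integral_nonpos_of_ae ((ae_restrict_iff' measurableSet_Ioo).2 ?_)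
    filter_upwards [h] with t ht hmem
    obtain ⟨f', h3, h4⟩ := ht hmem
    simpa [h3.deriv] using h4
  linarith

/-- Compare difference quotients. Meant for the distance to the starting point, which grows no
faster than the curve moves. -/
theorem HasDerivAt.le_norm_of_dist_le {E : Type*} [NormedAddCommGroup E] [NormedSpace ℝ E]
    {f : ℝ → ℝ} {g : ℝ → E} {f' t : ℝ} {g' : E} (hf : HasDerivAt f f' t) (hg : HasDerivAt g g' t)
    (h : ∀ s, dist (f s) (f t) ≤ dist (g s) (g t)) : f' ≤ ‖g'‖ := by
  have h1 := (hasDerivAt_iff_tendsto_slope.1 hf).norm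
  have h2 := (hasDerivAt_iff_tendsto_slope.1 hg).norm
  refine (le_abs_self f').trans (le_of_tendsto_of_tendsto' h1 h2 fun s => ?_)
  simp only [slope, norm_smul, vsub_eq_sub, ← dist_eq_norm]
  exact mul_le_mul_of_nonneg_left (h s) (norm_nonneg _)

end AbsolutelyContinuous

namespace TwoLayer

/-! ### Gradient flows: confinement and decay rate. -/

section GradientFlow

variable {Θ : Type*} [NormedAddCommGroup Θ] [InnerProductSpace ℝ Θ] [CompleteSpace Θ]
  {L : Θ → ℝ} {θ : ℝ → Θ}

/-- The trajectory over a compact interval is compact, so local Lipschitz continuity becomes a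
single Lipschitz constant along it. -/
theorem IsGradientFlow.absolutelyContinuous_loss (hθ : IsGradientFlow L θ) (hL : LocallyLipschitz L)
    {T : ℝ} (hT : 0 ≤ T) : AbsolutelyContinuousOnInterval (L ∘ θ) 0 T := by
  have hc := (hθ.1 T hT).continuousOn
  obtain ⟨K, hK⟩ := (hL.locallyLipschitzOn (s := θ '' Set.uIcc 0 T)).exists_lipschitzOnWith_of_compact
    (isCompact_uIcc.image_of_continuousOn hc)
  exact hK.comp_absolutelyContinuousOnInterval (hθ.1 T hT) (Set.mapsTo_image _ _)

theorem IsGradientFlow.ae_hasDerivAt_loss (hθ : IsGradientFlow L θ) :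
    ∀ᵐ t : ℝ, 0 < t → HasDerivAt (L ∘ θ) (-‖∇ L (θ t)‖ ^ 2) t := by
  filter_upwards [hθ.2] with t ht h0
  obtain ⟨h1, h2⟩ := ht h0
  have h3 := h1.hasGradientAt.hasFDerivAt.comp_hasDerivAt t h2
  rwa [map_neg, InnerProductSpace.toDual_apply_apply, real_inner_self_eq_norm_sq] at h3

theorem IsGradientFlow.antitoneOn_loss (hθ : IsGradientFlow L θ) (hL : LocallyLipschitz L) :
    AntitoneOn (L ∘ θ) (Set.Ici 0) := by
  intro s hs t ht hst
  have h0 : (0 : ℝ) ≤ s := hs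
  refine AbsolutelyContinuousOnInterval.le_of_ae_hasDerivAt_nonpos hst
    ((hθ.absolutelyContinuous_loss hL ht).mono ?_) ?_
  · rw [Set.uIcc_of_le hst, Set.uIcc_of_le ht]
    exact Set.Icc_subset_Icc_left hs
  · filter_upwards [hθ.ae_hasDerivAt_loss] with r hr hmem
    exact ⟨_, hr (h0.trans_lt hmem.1), by nlinarith [sq_nonneg ‖∇ L (θ r)‖]⟩

theorem IsGradientFlow.absolutelyContinuous_dist (hθ : IsGradientFlow L θ) {T : ℝ} (hT : 0 ≤ T) :
    AbsolutelyContinuousOnInterval (fun t => dist (θ t) (θ 0)) 0 T :=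
  ((LipschitzWith.dist_left (θ 0)).lipschitzOnWith (s := Set.univ)).comp_absolutelyContinuousOnInterval
    (hθ.1 T hT) (Set.mapsTo_univ _ _)

/-- As long as the Łojasiewicz-type inequality `L - ε ≤ ‖∇L‖ (dist + c)` holds along a gradient flow,
the product `(L - ε) (dist + c)` does not increase. -/
theorem IsGradientFlow.mul_dist_add_le (hθ : IsGradientFlow L θ) (hL : LocallyLipschitz L)
    {ε c T : ℝ} (hT : 0 ≤ T)
    (hpos : ∀ s ∈ Set.Ioo 0 T, ε ≤ L (θ s))
    (hgrad : ∀ s ∈ Set.Ioo 0 T, DifferentiableAt ℝ L (θ s) →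
      L (θ s) - ε ≤ ‖∇ L (θ s)‖ * (dist (θ s) (θ 0) + c)) :
    (L (θ T) - ε) * (dist (θ T) (θ 0) + c) ≤ (L (θ 0) - ε) * c := by
  have hconst : ∀ k : ℝ, AbsolutelyContinuousOnInterval (fun _ : ℝ => k) 0 T := fun k =>
    (LipschitzWith.const k).lipschitzOnWith.absolutelyContinuousOnInterval
  have hac := ((hθ.absolutelyContinuous_loss hL hT).sub (hconst ε)).mul
    ((hθ.absolutelyContinuous_dist hT).add (hconst c))
  have key := hac.le_of_ae_hasDerivAt_nonpos hT ?_
  · simpa using key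
  filter_upwards [hθ.2, hθ.ae_hasDerivAt_loss, (hθ.absolutelyContinuous_dist hT).ae_differentiableAt]
    with t h1 h2 h3 hmem
  obtain ⟨h4, h5⟩ := h1 hmem.1
  have h6 := (h3 (by rw [Set.uIcc_of_le hT]; exact Set.Ioo_subset_Icc_self hmem)).hasDerivAt
  have h7 := h6.le_norm_of_dist_le h5 fun s => by
    rw [Real.dist_eq]; exact abs_dist_sub_le _ _ _
  rw [norm_neg] at h7
  -- With `y`, `r`, `G` for the shifted loss, shifted distance and gradient norm, the derivative is
  -- `-G² r + y r' ≤ -G² r + y G = G (y - G r) ≤ 0`.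
  refine ⟨_, ((h2 hmem.1).sub_const ε).mul (h6.add_const c), ?_⟩
  have h8 := hgrad t hmem h4
  have h9 := hpos t hmem
  have h10 : (L (θ t) - ε) * deriv (fun t => dist (θ t) (θ 0)) t
      ≤ (L (θ t) - ε) * ‖∇ L (θ t)‖ := mul_le_mul_of_nonneg_left h7 (by linarith)
  have h11 := mul_le_mul_of_nonneg_left h8 (norm_nonneg (∇ L (θ t)))
  simp only [Function.comp_apply, Pi.add_apply]
  nlinarith

/-- Only times with loss above `2 ε` need an argument. By monotonicity the loss then exceeded `2 ε`
at all earlier times, so the shifted loss is bounded away from `0` and its power `-3` can be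
differentiated along the flow. This also disposes of a zero initial loss, where `0 ^ (-3) = 0`. -/
theorem IsGradientFlow.loss_le (hθ : IsGradientFlow L θ) (hL : LocallyLipschitz L)
    (hL0 : ∀ x, 0 ≤ L x)
    {ε c M : ℝ} (hε : 0 < ε) (hc : 0 < c) (hM : L (θ 0) ≤ M)
    (hgrad : ∀ x ∈ Metric.closedBall (θ 0) (c * M / ε), DifferentiableAt ℝ L x →
      L x - ε ≤ ‖∇ L x‖ * (dist x (θ 0) + c)) {t : ℝ} (ht : 0 ≤ t) :
    L (θ t) ≤ 2 * ε + 1 / (L (θ 0) ^ (-3 : ℤ) + 3 / (c * M) ^ 2 * t) ^ (1 / 3 : ℝ) := by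
  have hinv : 0 ≤ L (θ 0) ^ (-3 : ℤ) := zpow_nonneg (hL0 _) _
  have hnn : 0 ≤ L (θ 0) ^ (-3 : ℤ) + 3 / (c * M) ^ 2 * t := by positivity
  rcases le_or_gt (L (θ t)) (2 * ε) with hle | hlt
  · have : 0 ≤ 1 / (L (θ 0) ^ (-3 : ℤ) + 3 / (c * M) ^ 2 * t) ^ (1 / 3 : ℝ) := by positivity
    linarith
  have hanti := hθ.antitoneOn_loss hL
  have hlow : ∀ s, 0 ≤ s → s ≤ t → 2 * ε < L (θ s) := fun s h0 h1 =>
    hlt.trans_le (hanti h0 ht h1)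
  have hMpos : 0 < M := by have := hlow 0 le_rfl ht; linarith
  have hcont : ContinuousOn (fun s => dist (θ s) (θ 0)) (Set.Icc 0 t) := by
    simpa [Set.uIcc_of_le ht] using (hθ.absolutelyContinuous_dist ht).continuousOn
  -- At a first time `τ` with distance at least `c M / ε`, the gradient inequality holds on `(0,
  -- τ)`, so the product bound applies: `ε (dist + c) ≤ (M - ε) c`, contradicting `ε dist ≥ c M`.
  have hball : ∀ s, 0 ≤ s → s ≤ t → dist (θ s) (θ 0) < c * M / ε := by
    by_contra! hcon
    obtain ⟨s, hs0, hst, hs⟩ := hcon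
    have hcomp : IsCompact (Set.Icc 0 t ∩ (fun s => dist (θ s) (θ 0)) ⁻¹' Set.Ici (c * M / ε)) :=
      isCompact_Icc.of_isClosed_subset
        (hcont.preimage_isClosed_of_isClosed isClosed_Icc isClosed_Ici) Set.inter_subset_left
    obtain ⟨τ, ⟨⟨hτ0, hτt⟩, hτ⟩, hleast⟩ := hcomp.exists_isLeast ⟨s, ⟨hs0, hst⟩, hs⟩
    have h1 := hθ.mul_dist_add_le hL (ε := ε) (c := c) hτ0
      (fun r hr => by linarith [hlow r hr.1.le (hr.2.le.trans hτt)])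
      (fun r hr hd => hgrad _ (by
        rw [Metric.mem_closedBall]
        by_contra! hr'
        exact absurd (hleast ⟨⟨hr.1.le, hr.2.le.trans hτt⟩, hr'.le⟩) (not_le.2 hr.2)) hd)
    have h2 : c * M / ε ≤ dist (θ τ) (θ 0) := hτ
    have h3 := hlow τ hτ0 hτt
    rw [div_le_iff₀ hε] at h2
    have h4 : ε * (dist (θ τ) (θ 0) + c) ≤ (L (θ τ) - ε) * (dist (θ τ) (θ 0) + c) :=
      mul_le_mul_of_nonneg_right (by linarith) (by positivity)
    nlinarith
  have hg : ∀ s, 0 ≤ s → s ≤ t → DifferentiableAt ℝ L (θ s) →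
      L (θ s) - ε ≤ ‖∇ L (θ s)‖ * (dist (θ s) (θ 0) + c) := fun s h0 h1 =>
    hgrad _ (hball s h0 h1).le
  have hprod : ∀ s, 0 ≤ s → s ≤ t → (L (θ s) - ε) * (dist (θ s) (θ 0) + c) ≤ c * M := by
    intro s h0 h1
    have := hθ.mul_dist_add_le hL (ε := ε) (c := c) h0
      (fun r hr => by linarith [hlow r hr.1.le (hr.2.le.trans h1)])
      (fun r hr => hg r hr.1.le (hr.2.le.trans h1))
    nlinarith
  -- The singularity at `ε` is avoided because the losses stay in `[2 ε, L (θ 0)]`; there the power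
  -- is Lipschitz, and its composition with the loss is absolutely continuous.
  have hcd : ContDiffOn ℝ 1 (fun y : ℝ => (y - ε) ^ (-3 : ℤ)) (Set.Icc (2 * ε) (L (θ 0))) := by
    intro y hy
    have : y - ε ≠ 0 := by have := hy.1; intro h; linarith
    have h2 : ContDiffAt ℝ 1 (fun y : ℝ => ((y - ε) ^ 3)⁻¹) y :=
      ContDiffAt.inv (by fun_prop) (pow_ne_zero _ this)
    refine ContDiffAt.contDiffWithinAt (h2.congr_of_eventuallyEq (Filter.Eventually.of_forall ?_))
    intro z
    simp only [zpow_neg]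
    norm_cast
  obtain ⟨K, hK⟩ := hcd.exists_lipschitzOnWith one_ne_zero (convex_Icc _ _) isCompact_Icc
  have hac1 := hK.comp_absolutelyContinuousOnInterval (hθ.absolutelyContinuous_loss hL ht)
    (fun s hs => by
      rw [Set.uIcc_of_le ht] at hs
      exact ⟨(hlow s hs.1 hs.2).le, hanti (Set.mem_Ici.2 le_rfl) hs.1 hs.1⟩)
  have hac2 : AbsolutelyContinuousOnInterval (fun s : ℝ => 3 / (c * M) ^ 2 * s) 0 t :=
    (ContDiff.contDiffOn (n := 1) (by fun_prop)).absolutelyContinuousOnInterval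
  have key := (hac2.sub hac1).le_of_ae_hasDerivAt_nonpos ht ?_
  · simp only [Pi.sub_apply, Function.comp_apply, mul_zero, zero_sub] at key
    have h0 := hlow 0 le_rfl ht
    have hx : 0 < L (θ t) - ε := by linarith
    have h1 : L (θ 0) ^ (-3 : ℤ) ≤ (L (θ 0) - ε) ^ (-3 : ℤ) := by
      rw [zpow_neg, zpow_neg]
      have : 0 < L (θ 0) - ε := by linarith
      refine inv_anti₀ (by positivity) ?_
      exact zpow_le_zpow_left₀ (by norm_num) this.le (by linarith)
    have h2 : L (θ 0) ^ (-3 : ℤ) + 3 / (c * M) ^ 2 * t ≤ (L (θ t) - ε) ^ (-3 : ℤ) := by linarith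
    have hpos : 0 < L (θ 0) ^ (-3 : ℤ) + 3 / (c * M) ^ 2 * t := by
      have : 0 < L (θ 0) ^ (-3 : ℤ) := zpow_pos (by linarith) _
      positivity
    have h3 : (L (θ 0) ^ (-3 : ℤ) + 3 / (c * M) ^ 2 * t) ^ (1 / 3 : ℝ) ≤ (L (θ t) - ε)⁻¹ := by
      refine (Real.rpow_le_rpow hnn h2 (by norm_num)).trans_eq ?_
      rw [← Real.rpow_intCast, ← Real.rpow_mul hx.le, ← Real.rpow_neg_one]
      norm_num
    have h4 : L (θ t) - ε ≤ 1 / (L (θ 0) ^ (-3 : ℤ) + 3 / (c * M) ^ 2 * t) ^ (1 / 3 : ℝ) := by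
      rw [le_div_iff₀ (by positivity), mul_comm]
      calc _ ≤ (L (θ t) - ε)⁻¹ * (L (θ t) - ε) := mul_le_mul_of_nonneg_right h3 hx.le
        _ = 1 := inv_mul_cancel₀ hx.ne'
    linarith
  filter_upwards [hθ.2, hθ.ae_hasDerivAt_loss] with s h1 h2 hmem
  have hl := hlow s hmem.1.le hmem.2.le
  have hx : 0 < L (θ s) - ε := by linarith
  have hd := ((hasDerivAt_zpow (-3) (L (θ s) - ε) (Or.inl hx.ne')).comp s
    ((h2 hmem.1).sub_const ε))
  refine ⟨_, ((hasDerivAt_id s).const_mul (3 / (c * M) ^ 2)).sub hd, ?_⟩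
  have hg' := hg s hmem.1.le hmem.2.le (h1 hmem.1).1
  have hp := hprod s hmem.1.le hmem.2.le
  set x := L (θ s) - ε with hxdef
  set G := ‖∇ L (θ s)‖
  set q := dist (θ s) (θ 0) + c
  have hq : 0 < q := by positivity
  -- The distance is eliminated: `x ≤ G q` and `x q ≤ c M` leave a differential inequality in the
  -- loss alone.
  have h5 : x ^ 2 ≤ G * (c * M) := by
    calc x ^ 2 = x * x := sq x
      _ ≤ (G * q) * x := mul_le_mul_of_nonneg_right hg' hx.le
      _ = G * (x * q) := by ring
      _ ≤ G * (c * M) := mul_le_mul_of_nonneg_left hp (norm_nonneg _)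
  have h6 : x ^ 4 ≤ G ^ 2 * (c * M) ^ 2 := by
    calc x ^ 4 = (x ^ 2) ^ 2 := by ring
      _ ≤ (G * (c * M)) ^ 2 := pow_le_pow_left₀ (by positivity) h5 2
      _ = _ := by ring
  have h7 : x ^ (-4 : ℤ) = (x ^ 4)⁻¹ := by rw [zpow_neg]; norm_cast
  have h8 : 3 / (c * M) ^ 2 ≤ 3 * (x ^ 4)⁻¹ * G ^ 2 := by
    rw [div_le_iff₀ (by positivity)]
    have : (x ^ 4)⁻¹ * x ^ 4 = 1 := inv_mul_cancel₀ (by positivity)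
    nlinarith [mul_le_mul_of_nonneg_left h6 (show 0 ≤ 3 * (x ^ 4)⁻¹ by positivity)]
  have h9 : ((-3 : ℤ) : ℝ) * x ^ ((-3 : ℤ) - 1) * (-G ^ 2) = 3 * (x ^ 4)⁻¹ * G ^ 2 := by
    rw [show ((-3 : ℤ) - 1) = -4 by norm_num, h7]
    push_cast
    ring
  simp only [mul_one]
  rw [h9]
  linarith

end GradientFlow

/-! ### Coordinates of the parameter space. -/

section Parameters

variable {m d : ℕ}

@[simp]
theorem Param.w_add (θ θ' : Param m d) (i : Fin m) : (θ + θ').w i = θ.w i + θ'.w i := by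
  ext j; simp [Param.w]

@[simp]
theorem Param.w_sub (θ θ' : Param m d) (i : Fin m) : (θ - θ').w i = θ.w i - θ'.w i := by
  ext j; simp [Param.w]

@[simp]
theorem Param.w_smul (t : ℝ) (θ : Param m d) (i : Fin m) : (t • θ).w i = t • θ.w i := by
  ext j; simp [Param.w]

@[simp]
theorem Param.a_add (θ θ' : Param m d) (i : Fin m) : (θ + θ').a i = θ.a i + θ'.a i := by
  simp [Param.a]

@[simp]
theorem Param.a_sub (θ θ' : Param m d) (i : Fin m) : (θ - θ').a i = θ.a i - θ'.a i := by
  simp [Param.a]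

@[simp]
theorem Param.a_smul (t : ℝ) (θ : Param m d) (i : Fin m) : (t • θ).a i = t * θ.a i := by
  simp [Param.a]

theorem Param.norm_sq (θ : Param m d) :
    ‖θ‖ ^ 2 = ∑ i, ‖θ.w i‖ ^ 2 + ∑ i, θ.a i ^ 2 := by
  simp [EuclideanSpace.norm_sq_eq, Fintype.sum_sum_type, Fintype.sum_prod_type, Param.w, Param.a]

theorem Param.norm_w_le (θ : Param m d) (i : Fin m) : ‖θ.w i‖ ≤ ‖θ‖ := by
  refine le_of_sq_le_sq ?_ (norm_nonneg _)
  rw [θ.norm_sq]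
  have h1 := Finset.single_le_sum (f := fun i => ‖θ.w i‖ ^ 2) (fun i _ => sq_nonneg _)
    (Finset.mem_univ i)
  have h2 : 0 ≤ ∑ i, θ.a i ^ 2 := Finset.sum_nonneg fun i _ => sq_nonneg _
  linarith

theorem Param.abs_a_le (θ : Param m d) (i : Fin m) : |θ.a i| ≤ ‖θ‖ := by
  refine abs_le_of_sq_le_sq ?_ (norm_nonneg _)
  rw [θ.norm_sq]
  have h1 := Finset.single_le_sum (f := fun i => θ.a i ^ 2) (fun i _ => sq_nonneg _)
    (Finset.mem_univ i)
  have h2 : 0 ≤ ∑ i, ‖θ.w i‖ ^ 2 := Finset.sum_nonneg fun i _ => sq_nonneg _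
  linarith

@[fun_prop]
theorem Param.continuous_w (i : Fin m) : Continuous fun θ : Param m d => θ.w i := by
  unfold Param.w
  fun_prop

@[fun_prop]
theorem Param.continuous_a (i : Fin m) : Continuous fun θ : Param m d => θ.a i := by
  unfold Param.a
  fun_prop

/-- The parameter with the hidden weights of `θ` and output weights `b`. -/
def Param.withA (θ : Param m d) (b : Fin m → ℝ) : Param m d :=
  WithLp.toLp 2 (Sum.elim (fun k => θ (Sum.inl k)) b)

@[simp]
theorem Param.w_withA (θ : Param m d) (b : Fin m → ℝ) (i : Fin m) : (θ.withA b).w i = θ.w i := by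
  ext j; simp [Param.w, Param.withA]

@[simp]
theorem Param.a_withA (θ : Param m d) (b : Fin m → ℝ) (i : Fin m) : (θ.withA b).a i = b i := by
  simp [Param.a, Param.withA]

end Parameters

/-! ### Regularity of the loss and its convexity in the output weights. -/

section Regularity

variable {σ : ℝ → ℝ} {Lσ : ℝ≥0} {m d : ℕ} {D : Measure (Input d)} {f : Input d → ℝ}

theorem _root_.LipschitzWith.abs_sub_le (hσ : LipschitzWith Lσ σ) (s t : ℝ) :
    |σ s - σ t| ≤ Lσ * |s - t| := by
  simpa [Real.dist_eq] using hσ.dist_le_mul s t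

theorem _root_.LipschitzWith.abs_le (hσ : LipschitzWith Lσ σ) (s : ℝ) :
    |σ s| ≤ |σ 0| + Lσ * |s| := by
  have h := hσ.abs_sub_le s 0
  have h2 := abs_sub_abs_le_abs_sub (σ s) (σ 0)
  rw [sub_zero] at h
  linarith

theorem continuous_network (hσ : Continuous σ) :
    Continuous fun p : Param m d × Input d => network σ p.1 p.2 := by
  unfold network
  fun_prop

theorem abs_network_sub_le (hσ : LipschitzWith Lσ σ) {r B : ℝ} {θ θ' : Param m d}
    (hθ : ‖θ‖ ≤ r) (hθ' : ‖θ'‖ ≤ r) {x : Input d} (hx : ‖x‖ ≤ B) :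
    |network σ θ x - network σ θ' x| ≤ m * (|σ 0| + 2 * Lσ * r * B) * ‖θ - θ'‖ := by
  have hr : 0 ≤ r := (norm_nonneg _).trans hθ
  unfold network
  rw [← Finset.sum_sub_distrib]
  refine (Finset.abs_sum_le_sum_abs _ _).trans ?_
  have key : ∀ i ∈ Finset.univ, |θ.a i * σ (inner ℝ (θ.w i) x) - θ'.a i * σ (inner ℝ (θ'.w i) x)|
      ≤ (|σ 0| + 2 * Lσ * r * B) * ‖θ - θ'‖ := by
    intro i _
    have h1 : |σ (inner ℝ (θ.w i) x)| ≤ |σ 0| + Lσ * (r * B) := by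
      refine (hσ.abs_le _).trans ?_
      gcongr
      exact (abs_real_inner_le_norm _ _).trans
        (mul_le_mul ((θ.norm_w_le i).trans hθ) hx (norm_nonneg _) hr)
    have h2 : |σ (inner ℝ (θ.w i) x) - σ (inner ℝ (θ'.w i) x)| ≤ Lσ * (‖θ - θ'‖ * B) := by
      refine (hσ.abs_sub_le _ _).trans ?_
      rw [← inner_sub_left, ← Param.w_sub]
      gcongr
      exact (abs_real_inner_le_norm _ _).trans
        (mul_le_mul ((θ - θ').norm_w_le i) hx (norm_nonneg _) (norm_nonneg _))
    have h3 : |θ.a i - θ'.a i| ≤ ‖θ - θ'‖ := by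
      rw [← Param.a_sub]; exact (θ - θ').abs_a_le i
    have h4 : |θ'.a i| ≤ r := (θ'.abs_a_le i).trans hθ'
    calc _ = |(θ.a i - θ'.a i) * σ (inner ℝ (θ.w i) x)
          + θ'.a i * (σ (inner ℝ (θ.w i) x) - σ (inner ℝ (θ'.w i) x))| := by ring_nf
      _ ≤ |θ.a i - θ'.a i| * |σ (inner ℝ (θ.w i) x)|
          + |θ'.a i| * |σ (inner ℝ (θ.w i) x) - σ (inner ℝ (θ'.w i) x)| := by
        rw [← abs_mul, ← abs_mul]; exact abs_add_le _ _
      _ ≤ ‖θ - θ'‖ * (|σ 0| + Lσ * (r * B)) + r * (Lσ * (‖θ - θ'‖ * B)) := by gcongr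
      _ = _ := by ring
  refine (Finset.sum_le_sum key).trans_eq ?_
  simp [mul_assoc]

/-- The constant is uniform in `x`, so it can be integrated over the data and serve as a dominating
function. -/
theorem exists_lipschitzOnWith_sq (hσ : LipschitzWith Lσ σ) (m : ℕ) (r B A : ℝ) :
    ∃ C : ℝ≥0, ∀ x : Input d, ‖x‖ ≤ B → |f x| ≤ A →
      LipschitzOnWith C (fun θ : Param m d => (network σ θ x - f x) ^ 2)
        (Metric.closedBall 0 r) := by
  set P : ℝ := m * (|σ 0| + 2 * Lσ * r * B) with hP
  refine ⟨(P * (2 * (P * r + A))).toNNReal, fun x hx hfx => ?_⟩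
  refine LipschitzOnWith.of_dist_le_mul fun θ hθ θ' hθ' => ?_
  have hθ : ‖θ‖ ≤ r := by simpa using hθ
  have hθ' : ‖θ'‖ ≤ r := by simpa using hθ'
  have hr : 0 ≤ r := (norm_nonneg _).trans hθ
  have hB : 0 ≤ B := (norm_nonneg _).trans hx
  have hP0 : 0 ≤ P := by positivity
  have hbd : ∀ θ : Param m d, ‖θ‖ ≤ r → |network σ θ x - f x| ≤ P * r + A := by
    intro θ hθ
    -- The network vanishes at parameter `0`, so its Lipschitz bound also bounds its size.
    have h0 := abs_network_sub_le hσ hθ (θ' := 0) (by simpa using hr) hx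
    have hz : network σ (0 : Param m d) x = 0 := by simp [network, Param.a]
    rw [hz, sub_zero, sub_zero] at h0
    calc _ ≤ |network σ θ x| + |f x| := abs_sub _ _
      _ ≤ P * ‖θ‖ + A := add_le_add h0 hfx
      _ ≤ P * r + A := by gcongr
  rw [Real.dist_eq, dist_eq_norm]
  refine le_trans ?_ (mul_le_mul_of_nonneg_right (Real.le_coe_toNNReal _) (norm_nonneg _))
  have h1 := abs_network_sub_le hσ hθ hθ' hx
  calc _ = |network σ θ x - network σ θ' x|
        * |(network σ θ x - f x) + (network σ θ' x - f x)| := by rw [← abs_mul]; ring_nf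
    _ ≤ (P * ‖θ - θ'‖) * ((P * r + A) + (P * r + A)) :=
      mul_le_mul h1 ((abs_add_le _ _).trans (add_le_add (hbd θ hθ) (hbd θ' hθ'))) (abs_nonneg _)
        (by positivity)
    _ = _ := by ring

theorem integrable_of_continuous {K : Set (Input d)} [IsFiniteMeasure D] (hK : IsCompact K)
    (hD : D Kᶜ = 0) {E : Type*} [NormedAddCommGroup E] {g : Input d → E} (hg : Continuous g) :
    Integrable g D := by
  have h := hg.continuousOn.integrableOn_compact (μ := D) hK
  rwa [IntegrableOn, Measure.restrict_eq_self_of_ae_mem (mem_ae_iff.2 hD)] at h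

theorem exists_ae_bound {K : Set (Input d)} (hK : IsCompact K)
    (hD : D Kᶜ = 0) {E : Type*} [NormedAddCommGroup E] {g : Input d → E} (hg : Continuous g) :
    ∃ B : ℝ, 0 ≤ B ∧ ∀ᵐ x ∂D, ‖g x‖ ≤ B := by
  obtain ⟨B, hB⟩ := hK.exists_bound_of_continuousOn hg.continuousOn
  refine ⟨max B 0, le_max_right _ _, ?_⟩
  have : ∀ᵐ x ∂D, x ∈ K := mem_ae_iff.2 hD
  filter_upwards [this] with x hx
  exact (hB x hx).trans (le_max_left _ _)

theorem continuous_residual_sq (hσ : Continuous σ) (hf : Continuous f) :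
    Continuous fun p : Param m d × Input d => (network σ p.1 p.2 - f p.2) ^ 2 := by
  have := continuous_network (m := m) (d := d) hσ
  fun_prop

theorem integrable_residual_sq (hσ : Continuous σ) (hf : Continuous f) {K : Set (Input d)}
    [IsFiniteMeasure D] (hK : IsCompact K) (hD : D Kᶜ = 0) (θ : Param m d) :
    Integrable (fun x => (network σ θ x - f x) ^ 2) D :=
  integrable_of_continuous hK hD
    ((continuous_residual_sq hσ hf).comp (Continuous.prodMk_right θ))

theorem exists_ae_lipschitzOnWith_residual_sq (hσ : LipschitzWith Lσ σ) (hf : Continuous f)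
    {K : Set (Input d)} (hK : IsCompact K) (hD : D Kᶜ = 0) (m : ℕ) (r : ℝ) :
    ∃ C : ℝ≥0, ∀ᵐ x ∂D, LipschitzOnWith C (fun θ : Param m d => (network σ θ x - f x) ^ 2)
        (Metric.closedBall 0 r) := by
  obtain ⟨B, -, hB⟩ := exists_ae_bound hK hD continuous_id
  obtain ⟨A, -, hA⟩ := exists_ae_bound hK hD hf
  obtain ⟨C, hC⟩ := exists_lipschitzOnWith_sq (f := f) hσ m r B A
  exact ⟨C, by filter_upwards [hB, hA] with x h1 h2 using hC x h1 h2⟩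

theorem locallyLipschitz_loss (hσ : LipschitzWith Lσ σ) (hf : Continuous f)
    {K : Set (Input d)} [IsProbabilityMeasure D] (hK : IsCompact K) (hD : D Kᶜ = 0) (m : ℕ) :
    LocallyLipschitz (loss σ D f m) := by
  intro θ₀
  obtain ⟨C, hC⟩ := exists_ae_lipschitzOnWith_residual_sq hσ hf hK hD m (‖θ₀‖ + 1)
  refine ⟨C, Metric.closedBall 0 (‖θ₀‖ + 1), ?_, ?_⟩
  · refine Metric.closedBall_mem_nhds_of_mem ?_
    simp
  · refine LipschitzOnWith.of_dist_le_mul fun θ hθ θ' hθ' => ?_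
    unfold loss sqSeminorm
    rw [dist_eq_norm, ← integral_sub (integrable_residual_sq hσ.continuous hf hK hD θ)
      (integrable_residual_sq hσ.continuous hf hK hD θ')]
    have h := norm_integral_le_of_norm_le_const (μ := D) (C := C * dist θ θ')
      (f := fun x => (network σ θ x - f x) ^ 2 - (network σ θ' x - f x) ^ 2) (by
        filter_upwards [hC] with x hx
        rw [← dist_eq_norm]
        exact hx.dist_le_mul θ hθ θ' hθ')
    simpa using h

theorem differentiable_network (hd : Differentiable ℝ σ) (x : Input d) :
    Differentiable ℝ fun θ : Param m d => network σ θ x := by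
  have hk : ∀ k : (Fin m × Fin d) ⊕ Fin m, Differentiable ℝ fun θ : Param m d => θ k := fun k =>
    (EuclideanSpace.proj k : Param m d →L[ℝ] ℝ).differentiable
  unfold network Param.a Param.w
  simp only [PiLp.inner_apply, RCLike.inner_apply, conj_trivial]
  refine Differentiable.fun_sum fun i _ => (hk _).mul (hd.comp ?_)
  exact Differentiable.fun_sum fun j _ => (hk _).const_mul _

theorem _root_.Continuous.measurable_fderiv_left {α E : Type*} [TopologicalSpace α]
    [MeasurableSpace α] [OpensMeasurableSpace α] [NormedAddCommGroup E] [NormedSpace ℝ E]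
    [FiniteDimensional ℝ E] {g : α → E → ℝ} (hg : Continuous g.uncurry) (e : E) :
    Measurable fun x => fderiv ℝ (g x) e := by
  borelize E
  exact (measurable_fderiv_with_param ℝ hg).comp measurable_prodMk_right

theorem measurable_fderiv_residual_sq (hσ : Continuous σ) (hf : Continuous f) (θ₀ : Param m d) :
    Measurable fun x : Input d =>
      fderiv ℝ (fun θ : Param m d => (network σ θ x - f x) ^ 2) θ₀ :=
  Continuous.measurable_fderiv_left (g := fun (x : Input d) (θ : Param m d) =>
    (network σ θ x - f x) ^ 2) ((continuous_residual_sq hσ hf).comp continuous_swap) θ₀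

/-- Differentiation under the integral, dominated by the Lipschitz constant on a ball around the
point. -/
theorem differentiable_loss (hσ : LipschitzWith Lσ σ) (hd : Differentiable ℝ σ)
    (hf : Continuous f) {K : Set (Input d)} [IsProbabilityMeasure D] (hK : IsCompact K)
    (hD : D Kᶜ = 0) (m : ℕ) : Differentiable ℝ (loss σ D f m) := by
  intro θ₀
  obtain ⟨C, hC⟩ := exists_ae_lipschitzOnWith_residual_sq hσ hf hK hD m (‖θ₀‖ + 1)
  have h := hasFDerivAt_integral_of_dominated_loc_of_lip (𝕜 := ℝ) (μ := D) (x₀ := θ₀)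
    (F := fun (θ : Param m d) x => (network σ θ x - f x) ^ 2) (bound := fun _ => (C : ℝ))
    (F' := fun x => fderiv ℝ (fun θ : Param m d => (network σ θ x - f x) ^ 2) θ₀)
    (s := Metric.closedBall 0 (‖θ₀‖ + 1))
    (Metric.closedBall_mem_nhds_of_mem (by simp))
    (Filter.Eventually.of_forall fun θ =>
      (integrable_residual_sq hσ.continuous hf hK hD θ).aestronglyMeasurable)
    (integrable_residual_sq hσ.continuous hf hK hD θ₀)
    (measurable_fderiv_residual_sq hσ.continuous hf θ₀).aestronglyMeasurable
    (by filter_upwards [hC] with x hx; simpa using hx)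
    (integrable_const _)
    (Filter.Eventually.of_forall fun x =>
      (((differentiable_network hd x).sub_const (f x)).pow 2 θ₀).hasFDerivAt)
  exact h.2.differentiableAt

theorem loss_nonneg (θ : Param m d) : 0 ≤ loss σ D f m θ :=
  integral_nonneg fun _ => sq_nonneg _

/-- The right difference quotients at `0` are at most the slope of the chord over `[0, 1]`. Only
this chord is used, not full convexity. -/
theorem _root_.HasDerivAt.le_sub_of_le_segment {φ : ℝ → ℝ} {φ' : ℝ} (h : HasDerivAt φ φ' 0)
    (hc : ∀ t ∈ Set.Ioo (0 : ℝ) 1, φ t ≤ (1 - t) * φ 0 + t * φ 1) : φ' ≤ φ 1 - φ 0 := by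
  have h1 := (hasDerivWithinAt_iff_tendsto_slope' (s := Set.Ioi 0) (by simp)).1
    (h.hasDerivWithinAt (s := Set.Ioi 0))
  refine le_of_tendsto h1 ?_
  filter_upwards [Ioo_mem_nhdsGT (zero_lt_one (α := ℝ))] with t ht
  rw [slope_def_field, sub_zero, div_le_iff₀ ht.1]
  have := hc t ht
  linarith

theorem network_segment (θ : Param m d) (b : Fin m → ℝ) (t : ℝ) (x : Input d) :
    network σ (θ + t • (θ.withA b - θ)) x
      = (1 - t) * network σ θ x + t * network σ (θ.withA b) x := by
  simp only [network, Param.a_add, Param.a_smul, Param.a_sub, Param.a_withA, Param.w_add,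
    Param.w_smul, Param.w_sub, Param.w_withA, sub_self, smul_zero, add_zero, Finset.mul_sum,
    ← Finset.sum_add_distrib]
  exact Finset.sum_congr rfl fun i _ => by ring

/-- Convexity of the loss in the output weights. -/
theorem loss_sub_loss_withA_le (hσ : Continuous σ) (hf : Continuous f) {K : Set (Input d)}
    [IsProbabilityMeasure D] (hK : IsCompact K) (hD : D Kᶜ = 0) {θ : Param m d}
    (hθ : DifferentiableAt ℝ (loss σ D f m) θ) (b : Fin m → ℝ) :
    loss σ D f m θ - loss σ D f m (θ.withA b)
      ≤ ‖∇ (loss σ D f m) θ‖ * ‖θ.withA b - θ‖ := by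
  set h := θ.withA b - θ with hh
  have hline : HasDerivAt (fun t : ℝ => θ + t • h) h 0 := by
    simpa using ((hasDerivAt_id (0 : ℝ)).smul_const h).const_add θ
  have hderiv : HasDerivAt (fun t : ℝ => loss σ D f m (θ + t • h))
      (inner ℝ (∇ (loss σ D f m) θ) h) 0 := by
    have h0 : HasGradientAt (loss σ D f m) (∇ (loss σ D f m) θ) (θ + (0 : ℝ) • h) := by
      simpa using hθ.hasGradientAt
    have := h0.hasFDerivAt.comp_hasDerivAt (0 : ℝ) hline
    rwa [InnerProductSpace.toDual_apply_apply] at this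
  have key := hderiv.le_sub_of_le_segment fun t ht => ?_
  · have h1 := abs_real_inner_le_norm (∇ (loss σ D f m) θ) h
    have h2 := neg_abs_le (inner ℝ (∇ (loss σ D f m) θ) h)
    simp only [one_smul, zero_smul, add_zero, hh, add_sub_cancel] at key
    linarith
  · simp only [one_smul, zero_smul, add_zero]
    have h1 : θ + h = θ.withA b := by simp [hh]
    rw [h1]
    have i0 := integrable_residual_sq (m := m) hσ hf hK hD
    unfold loss sqSeminorm
    rw [← integral_const_mul, ← integral_const_mul,
      ← integral_add ((i0 _).const_mul _) ((i0 _).const_mul _)]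
    refine integral_mono (i0 _) (((i0 _).const_mul _).add ((i0 _).const_mul _)) fun x => ?_
    simp only [hh, network_segment]
    have ht0 := ht.1
    have ht1 := ht.2
    -- The convexity gap of the square is exactly `t (1 - t)` times the squared difference of the
    -- two networks.
    nlinarith [mul_nonneg (mul_nonneg ht0.le (sub_nonneg.2 ht1.le))
      (sq_nonneg (network σ θ x - network σ (θ.withA b) x))]

end Regularity

end TwoLayer

/-! ### Recognizing polynomials and affine functions. -/

section Polynomials

theorem Polynomial.exists_derivative_eq (q : Polynomial ℝ) :
    ∃ p : Polynomial ℝ, p.derivative = q := by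
  induction q using Polynomial.induction_on' with
  | add p q hp hq =>
    obtain ⟨P, rfl⟩ := hp
    obtain ⟨Q, rfl⟩ := hq
    exact ⟨P + Q, by simp⟩
  | monomial n a =>
    refine ⟨Polynomial.monomial (n + 1) (a / (n + 1)), ?_⟩
    rw [Polynomial.derivative_monomial]
    congr 1
    push_cast
    field_simp

theorem ContDiff.exists_polynomial_of_iteratedDeriv_eq_zero (k : ℕ) {g : ℝ → ℝ}
    (hg : ContDiff ℝ (⊤ : ℕ∞) g) (h : ∀ x, iteratedDeriv k g x = 0) :
    ∃ p : Polynomial ℝ, ∀ x, g x = p.eval x := by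
  induction k generalizing g with
  | zero => exact ⟨0, fun x => by simpa using h x⟩
  | succ k ih =>
    have hd : ContDiff ℝ (⊤ : ℕ∞) (deriv g) := (contDiff_infty_iff_deriv.1 hg).2
    obtain ⟨q, hq⟩ := ih hd fun x => by rw [← iteratedDeriv_succ']; exact h x
    obtain ⟨p, rfl⟩ := q.exists_derivative_eq
    have hgd : Differentiable ℝ g := (contDiff_infty_iff_deriv.1 hg).1
    have hconst := is_const_of_deriv_eq_zero (f := fun x => g x - p.eval x)
      (hgd.sub p.differentiable) fun x => by
        rw [deriv_fun_sub (hgd x) p.differentiableAt, Polynomial.deriv, hq, sub_self]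
    refine ⟨p + Polynomial.C (g 0 - p.eval 0), fun x => ?_⟩
    have := hconst x 0
    simp only [Polynomial.eval_add, Polynomial.eval_C]
    linarith

/-- After removal of the constant term and division by `X`, the quotient is bounded at `+∞`, hence
constant. -/
theorem Polynomial.eval_eq_of_abs_le {p : Polynomial ℝ} {A C : ℝ}
    (h : ∀ x, |p.eval x| ≤ A + C * |x|) (x : ℝ) :
    p.eval x = p.eval 0 + (p.eval 1 - p.eval 0) * x := by
  have hdeg : p.divX.degree ≤ 0 := by
    rw [← Polynomial.isBoundedUnder_abs_atTop_iff]
    refine ⟨A + C + |p.coeff 0|, ?_⟩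
    rw [Filter.eventually_map]
    filter_upwards [Filter.eventually_ge_atTop (1 : ℝ)] with x hx
    have h1 : p.divX.eval x * x + p.coeff 0 = p.eval x := by
      conv_rhs => rw [← p.divX_mul_X_add]
      simp
    have h2 := h x
    rw [abs_of_pos (by linarith : 0 < x)] at h2
    have h3 : |p.divX.eval x| * x ≤ A + C * x + |p.coeff 0| := by
      calc |p.divX.eval x| * x = |p.eval x - p.coeff 0| := by
            rw [← h1, add_sub_cancel_right, abs_mul, abs_of_pos (by linarith : 0 < x)]
        _ ≤ |p.eval x| + |p.coeff 0| := abs_sub _ _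
        _ ≤ _ := by linarith
    have hA : 0 ≤ A := by simpa using (abs_nonneg _).trans (h 0)
    have h4 : A ≤ A * x := le_mul_of_one_le_right hA hx
    have h5 : |p.coeff 0| ≤ |p.coeff 0| * x := le_mul_of_one_le_right (abs_nonneg _) hx
    exact le_of_mul_le_mul_right (by linarith) (by linarith : 0 < x)
  obtain ⟨a, ha⟩ : ∃ a, p.divX = Polynomial.C a := ⟨_, Polynomial.eq_C_of_degree_le_zero hdeg⟩
  have hp : p = Polynomial.C a * Polynomial.X + Polynomial.C (p.coeff 0) := by
    conv_lhs => rw [← p.divX_mul_X_add, ha]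
  rw [hp]
  simp
  ring

end Polynomials

namespace TwoLayer

/-! ### Smoothing the activation. -/

section Mollification

variable {σ : ℝ → ℝ} {Lσ : ℝ≥0}

/-- The mollification of `σ` by the normalized bump function `φ`. -/
noncomputable def mollify (φ : ContDiffBump (0 : ℝ)) (σ : ℝ → ℝ) : ℝ → ℝ :=
  convolution (φ.normed volume) σ (ContinuousLinearMap.lsmul ℝ ℝ) volume

theorem mollify_apply (φ : ContDiffBump (0 : ℝ)) (s : ℝ) :
    mollify φ σ s = ∫ y, φ.normed volume y * σ (s - y) := by
  simp [mollify, convolution_def]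

theorem contDiff_mollify (φ : ContDiffBump (0 : ℝ)) (hσ : Continuous σ) :
    ContDiff ℝ (⊤ : ℕ∞) (mollify φ σ) :=
  HasCompactSupport.contDiff_convolution_left _ φ.hasCompactSupport_normed φ.contDiff_normed
    hσ.locallyIntegrable

theorem abs_mollify_sub_le (φ : ContDiffBump (0 : ℝ)) (hσ : LipschitzWith Lσ σ) (s : ℝ) :
    |mollify φ σ s - σ s| ≤ Lσ * φ.rOut := by
  rw [← Real.dist_eq]
  refine ContDiffBump.dist_normed_convolution_le hσ.continuous.aestronglyMeasurable fun y hy => ?_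
  refine (hσ.dist_le_mul y s).trans ?_
  gcongr
  exact (Metric.mem_ball.1 hy).le

/-- A Lipschitz function that is not a polynomial has a mollification none of whose derivatives
vanishes identically. -/
theorem exists_mollify_iteratedDeriv_ne_zero (hσ : LipschitzWith Lσ σ)
    (hpoly : ¬ ∃ p : Polynomial ℝ, ∀ s : ℝ, σ s = p.eval s) :
    ∃ φ : ContDiffBump (0 : ℝ), ∀ k : ℕ, ∃ b, iteratedDeriv k (mollify φ σ) b ≠ 0 := by
  by_contra! hcon
  refine hpoly ⟨Polynomial.C (σ 1 - σ 0) * Polynomial.X + Polynomial.C (σ 0), fun s => ?_⟩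
  -- The vanishing order may depend on `φ`, so the degree is not controlled directly; the linear
  -- growth inherited from `σ` forces it to be at most one. Affine functions survive the limit as
  -- the bumps shrink.
  have haff : ∀ φ : ContDiffBump (0 : ℝ), mollify φ σ s
      = mollify φ σ 0 + (mollify φ σ 1 - mollify φ σ 0) * s := by
    intro φ
    obtain ⟨k, hk⟩ := hcon φ
    obtain ⟨p, hp⟩ := (contDiff_mollify φ hσ.continuous).exists_polynomial_of_iteratedDeriv_eq_zero
      k hk
    rw [hp s, hp 0, hp 1]
    refine Polynomial.eval_eq_of_abs_le (A := Lσ * φ.rOut + |σ 0|) (C := Lσ) (fun x => ?_) s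
    rw [← hp x]
    have h1 := abs_mollify_sub_le φ hσ x
    have h2 := hσ.abs_le x
    have h3 := abs_sub_abs_le_abs_sub (mollify φ σ x) (σ x)
    linarith
  have hlim : ∀ x, Filter.Tendsto (fun n : ℕ => mollify
      (⟨1 / ((n : ℝ) + 1) / 2, 1 / ((n : ℝ) + 1), by positivity,
        half_lt_self (by positivity)⟩ : ContDiffBump (0 : ℝ)) σ x) Filter.atTop (nhds (σ x)) := by
    intro x
    rw [tendsto_iff_dist_tendsto_zero]
    have h0 : Filter.Tendsto (fun n : ℕ => Lσ * (1 / ((n : ℝ) + 1))) Filter.atTop (nhds 0) := by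
      simpa using (tendsto_one_div_add_atTop_nhds_zero_nat (𝕜 := ℝ)).const_mul (Lσ : ℝ)
    exact squeeze_zero (fun _ => dist_nonneg) (fun n => abs_mollify_sub_le _ hσ x) h0
  have h1 := hlim s
  have h2 := (hlim 0).add (((hlim 1).sub (hlim 0)).mul_const s)
  simp only [haff _] at h1
  have h3 := tendsto_nhds_unique h1 h2
  simp only [Polynomial.eval_add, Polynomial.eval_mul, Polynomial.eval_C, Polynomial.eval_X]
  linarith

end Mollification

/-! ### Functions orthogonal to all neurons vanish. -/

section Annihilator

variable {σ : ℝ → ℝ} {Lσ : ℝ≥0} {d : ℕ} {D : Measure (Input d)} {K : Set (Input d)}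
  {h : Input d → ℝ} {v : Input d}

theorem integrable_mul_continuous (hK : IsCompact K) (hD : D Kᶜ = 0) (hh : Integrable h D)
    {g : Input d → ℝ} (hg : Continuous g) : Integrable (fun x => h x * g x) D := by
  obtain ⟨B, -, hB⟩ := exists_ae_bound hK hD hg
  exact hh.mul_bdd hg.aestronglyMeasurable hB

/-- On `K`, `w · x - y = (w - y v) · x`: every translate of a neuron is again a neuron. Fubini does
the rest. -/
theorem integral_mul_mollify_eq_zero [IsFiniteMeasure D] (hK : IsCompact K) (hD : D Kᶜ = 0)
    (hv : ∀ x ∈ K, inner ℝ v x = 1) (hσ : Continuous σ) (hh : Integrable h D)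
    (horth : ∀ w, ∫ x, h x * σ (inner ℝ w x) ∂D = 0) (φ : ContDiffBump (0 : ℝ)) (w : Input d) :
    ∫ x, h x * mollify φ σ (inner ℝ w x) ∂D = 0 := by
  have hvae : ∀ᵐ x ∂D, inner ℝ v x = 1 := by
    have : ∀ᵐ x ∂D, x ∈ K := mem_ae_iff.2 hD
    filter_upwards [this] with x hx using hv x hx
  set ψ := φ.normed volume with hψ
  have hψc : Continuous ψ := φ.continuous_normed
  have hψs : HasCompactSupport ψ := φ.hasCompactSupport_normed
  have hint : Integrable (Function.uncurry fun (x : Input d) (y : ℝ) =>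
      h x * (ψ y * σ (inner ℝ w x - y))) (D.prod volume) := by
    have hKy : IsCompact ((fun p : Input d × ℝ => inner ℝ w p.1 - p.2) '' (K ×ˢ tsupport ψ)) :=
      (hK.prod hψs).image (by fun_prop)
    obtain ⟨C, hC⟩ := hKy.exists_bound_of_continuousOn hσ.continuousOn
    have h0 : Integrable (fun z : Input d × ℝ => h z.1 * ψ z.2) (D.prod volume) :=
      hh.mul_prod (hψc.integrable_of_hasCompactSupport hψs)
    have hKae : ∀ᵐ z ∂(D.prod (volume : Measure ℝ)), z.1 ∈ K :=
      Measure.quasiMeasurePreserving_fst.ae (mem_ae_iff.2 hD)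
    refine Integrable.mono (h0.const_mul C) ?_ ?_
    · refine (hh.aestronglyMeasurable.comp_fst).mul ?_
      exact (by fun_prop : Continuous fun z : Input d × ℝ =>
        ψ z.2 * σ (inner ℝ w z.1 - z.2)).aestronglyMeasurable
    · filter_upwards [hKae] with z hz
      simp only [Function.uncurry, norm_mul]
      by_cases hy : z.2 ∈ tsupport ψ
      · have h1 := hC _ ⟨z, ⟨hz, hy⟩, rfl⟩
        have h2 : ‖σ (inner ℝ w z.1 - z.2)‖ ≤ ‖C‖ := h1.trans (le_abs_self C)
        calc ‖h z.1‖ * (‖ψ z.2‖ * ‖σ (inner ℝ w z.1 - z.2)‖)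
            ≤ ‖h z.1‖ * (‖ψ z.2‖ * ‖C‖) := by gcongr
          _ = _ := by ring
      · simp [image_eq_zero_of_notMem_tsupport hy]
  have h1 : ∀ x, h x * mollify φ σ (inner ℝ w x)
      = ∫ y, h x * (ψ y * σ (inner ℝ w x - y)) := fun x => by
    rw [integral_const_mul, mollify_apply]
  simp_rw [h1]
  rw [integral_integral_swap hint]
  refine integral_eq_zero_of_ae (Filter.Eventually.of_forall fun y => ?_)
  have h2 : ∫ x, h x * (ψ y * σ (inner ℝ w x - y)) ∂D
      = ψ y * ∫ x, h x * σ (inner ℝ (w - y • v) x) ∂D := by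
    rw [← integral_const_mul]
    refine integral_congr_ae ?_
    filter_upwards [hvae] with x hx
    rw [inner_sub_left, real_inner_smul_left, hx, mul_one]
    ring
  simp only [h2, horth, mul_zero, Pi.zero_apply]

/-- Each derivative of the zero function `t ↦ ∫ h ρ⁽ᵏ⁾((u + t w) · x) (w · x)^k` at `t = 0` brings
out one more factor `w · x`. The induction needs all base points `u`. -/
theorem integral_mul_iteratedDeriv_eq_zero [IsFiniteMeasure D] (hK : IsCompact K) (hD : D Kᶜ = 0)
    {ρ : ℝ → ℝ} (hρ : ContDiff ℝ (⊤ : ℕ∞) ρ) (hh : Integrable h D)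
    (horth : ∀ w, ∫ x, h x * ρ (inner ℝ w x) ∂D = 0) (w : Input d) (k : ℕ) (u : Input d) :
    ∫ x, h x * (inner ℝ w x ^ k * iteratedDeriv k ρ (inner ℝ u x)) ∂D = 0 := by
  induction k generalizing u with
  | zero => simpa using horth u
  | succ k ih =>
    have hck : ∀ k : ℕ, Continuous (iteratedDeriv k ρ) := fun k =>
      hρ.continuous_iteratedDeriv k (by exact_mod_cast le_top)
    have hc : ∀ k : ℕ, Continuous fun p : ℝ × Input d =>
        inner ℝ w p.2 ^ k * iteratedDeriv k ρ (inner ℝ (u + p.1 • w) p.2) := fun k => by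
      have := hck k
      fun_prop
    obtain ⟨C, hC⟩ := (isCompact_Icc (a := (-1 : ℝ)) (b := 1)).prod hK
      |>.exists_bound_of_continuousOn (hc (k + 1)).continuousOn
    have hKae : ∀ᵐ x ∂D, x ∈ K := mem_ae_iff.2 hD
    have hint : ∀ (k : ℕ) (t : ℝ), Integrable (fun x => h x *
        (inner ℝ w x ^ k * iteratedDeriv k ρ (inner ℝ (u + t • w) x))) D := fun k t =>
      integrable_mul_continuous hK hD hh ((hc k).comp (Continuous.prodMk_right t))
    have hder := (hasDerivAt_integral_of_dominated_loc_of_deriv_le (𝕜 := ℝ) (μ := D) (x₀ := (0 : ℝ))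
      (F := fun t x => h x * (inner ℝ w x ^ k * iteratedDeriv k ρ (inner ℝ (u + t • w) x)))
      (F' := fun t x => h x *
        (inner ℝ w x ^ (k + 1) * iteratedDeriv (k + 1) ρ (inner ℝ (u + t • w) x)))
      (bound := fun x => ‖h x‖ * C) (s := Set.Icc (-1) 1)
      (Icc_mem_nhds (by norm_num) (by norm_num))
      (Filter.Eventually.of_forall fun t => (hint k t).aestronglyMeasurable) (hint k 0)
      (hint (k + 1) 0).aestronglyMeasurable
      (by
        filter_upwards [hKae] with x hx t ht
        rw [norm_mul]
        exact mul_le_mul_of_nonneg_left (hC (t, x) ⟨ht, hx⟩) (norm_nonneg _))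
      (hh.norm.mul_const C)
      (Filter.Eventually.of_forall fun x t _ => by
        have h1 : HasDerivAt (fun t : ℝ => inner ℝ (u + t • w) x) (inner ℝ w x) t := by
          have : (fun t : ℝ => inner ℝ (u + t • w) x)
              = fun t : ℝ => inner ℝ u x + t * inner ℝ w x := by
            funext t
            rw [inner_add_left, real_inner_smul_left]
          rw [this]
          simpa using ((hasDerivAt_id t).mul_const (inner ℝ w x)).const_add (inner ℝ u x)
        have h2 : HasDerivAt (iteratedDeriv k ρ)
            (iteratedDeriv (k + 1) ρ (inner ℝ (u + t • w) x)) (inner ℝ (u + t • w) x) := by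
          rw [iteratedDeriv_succ]
          exact (hρ.differentiable_iteratedDeriv k
            (by exact_mod_cast ENat.natCast_lt_top k) _).hasDerivAt
        have h3 := ((h2.comp t h1).const_mul (inner ℝ w x ^ k)).const_mul (h x)
        exact h3.congr_deriv (by ring))).2
    have hzero : (fun t : ℝ => ∫ x, h x *
        (inner ℝ w x ^ k * iteratedDeriv k ρ (inner ℝ (u + t • w) x)) ∂D) = fun _ => 0 := by
      funext t
      exact ih _
    rw [hzero] at hder
    simpa using hder.unique (hasDerivAt_const (0 : ℝ) (0 : ℝ))

/-- At base point `b • v` the argument of the derivative is the constant `b` on `K`; choosing `b`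
with a nonzero `k`-th derivative isolates the moment. -/
theorem integral_mul_pow_eq_zero [IsFiniteMeasure D] (hK : IsCompact K) (hD : D Kᶜ = 0)
    (hv : ∀ x ∈ K, inner ℝ v x = 1) (hσ : LipschitzWith Lσ σ)
    (hpoly : ¬ ∃ p : Polynomial ℝ, ∀ s : ℝ, σ s = p.eval s) (hh : Integrable h D)
    (horth : ∀ w, ∫ x, h x * σ (inner ℝ w x) ∂D = 0) (w : Input d) (k : ℕ) :
    ∫ x, h x * inner ℝ w x ^ k ∂D = 0 := by
  obtain ⟨φ, hφ⟩ := exists_mollify_iteratedDeriv_ne_zero hσ hpoly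
  obtain ⟨b, hb⟩ := hφ k
  have h1 := integral_mul_iteratedDeriv_eq_zero hK hD (contDiff_mollify φ hσ.continuous) hh
    (integral_mul_mollify_eq_zero hK hD hv hσ.continuous hh horth φ) w k (b • v)
  have h2 : ∫ x, h x * (inner ℝ w x ^ k * iteratedDeriv k (mollify φ σ) (inner ℝ (b • v) x)) ∂D
      = (∫ x, h x * inner ℝ w x ^ k ∂D) * iteratedDeriv k (mollify φ σ) b := by
    rw [← integral_mul_const]
    refine integral_congr_ae ?_
    have hKae : ∀ᵐ x ∂D, x ∈ K := mem_ae_iff.2 hD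
    filter_upwards [hKae] with x hx
    rw [real_inner_smul_left, hv x hx, mul_one, mul_assoc]
  rw [h2] at h1
  exact (mul_eq_zero.1 h1).resolve_right hb

/-- The exponential series may be integrated termwise since `w · x` is bounded by some `B` almost
everywhere, making the terms summable like `B^k / k!`. -/
theorem integral_mul_cexp_eq_zero [IsFiniteMeasure D] (hK : IsCompact K) (hD : D Kᶜ = 0)
    (hh : Integrable h D) (hmom : ∀ w k, ∫ x, h x * inner ℝ w x ^ k ∂D = 0) (w : Input d) :
    ∫ x, (h x : ℂ) * Complex.exp (inner ℝ x w * Complex.I) ∂D = 0 := by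
  obtain ⟨B, hB0, hB⟩ := exists_ae_bound hK hD (g := fun x : Input d => (inner ℝ w x : ℝ))
    (by fun_prop)
  set F : ℕ → Input d → ℂ := fun k x =>
    ((h x * inner ℝ w x ^ k : ℝ) : ℂ) * (Complex.I ^ k / k.factorial) with hF
  have hint : ∀ k, Integrable (fun x => h x * inner ℝ w x ^ k) D := fun k =>
    integrable_mul_continuous hK hD hh (by fun_prop)
  have hFint : ∀ k, Integrable (F k) D := fun k => (hint k).ofReal.mul_const _
  have hnorm : ∀ k x, ‖F k x‖ = |h x| * |inner ℝ w x| ^ k / k.factorial := by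
    intro k x
    simp only [hF, norm_mul, Complex.norm_real, norm_div, norm_pow, Complex.norm_I, one_pow,
      Complex.norm_natCast, Real.norm_eq_abs]
    ring
  have hsum : Summable fun k => ∫ x, ‖F k x‖ ∂D := by
    refine Summable.of_nonneg_of_le (fun k => integral_nonneg fun _ => norm_nonneg _)
      (fun k => ?_) ((Real.summable_pow_div_factorial B).mul_left (∫ x, |h x| ∂D))
    rw [← integral_mul_const]
    refine integral_mono_ae (hFint k).norm (hh.abs.mul_const _) ?_
    filter_upwards [hB] with x hx
    rw [hnorm, mul_div_assoc]
    rw [Real.norm_eq_abs] at hx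
    gcongr
  have h1 := hasSum_integral_of_summable_integral_norm hFint hsum
  have h2 : ∀ k, ∫ x, F k x ∂D = 0 := by
    intro k
    simp only [hF]
    rw [integral_mul_const, integral_complex_ofReal, hmom w k]
    simp
  have h3 : ∀ x, ∑' k, F k x = (h x : ℂ) * Complex.exp (inner ℝ x w * Complex.I) := by
    intro x
    have h4 := (NormedSpace.expSeries_div_hasSum_exp
      ((inner ℝ x w : ℂ) * Complex.I)).mul_left (h x : ℂ)
    rw [← Complex.exp_eq_exp_ℂ] at h4
    rw [← h4.tsum_eq]
    refine tsum_congr fun k => ?_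
    simp only [hF, real_inner_comm w x]
    push_cast
    ring
  simp_rw [h3, h2] at h1
  exact h1.unique hasSum_zero

/-- The positive and negative parts of `h` are densities of two finite measures with equal
characteristic functions, hence of equal measures. -/
theorem ae_eq_zero_of_integral_mul_cexp_eq_zero [IsFiniteMeasure D] (hm : Measurable h)
    (hh : Integrable h D)
    (horth : ∀ w, ∫ x, (h x : ℂ) * Complex.exp (inner ℝ x w * Complex.I) ∂D = 0) :
    h =ᵐ[D] 0 := by
  have hfin : ∀ g : Input d → ℝ, Integrable g D → ∫⁻ x, ENNReal.ofReal (g x) ∂D ≠ ∞ := fun g hg =>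
    hg.lintegral_lt_top.ne
  have hp := hfin h hh
  have hn := hfin (-h) hh.neg
  have : IsFiniteMeasure (D.withDensity fun x => ENNReal.ofReal (h x)) :=
    isFiniteMeasure_withDensity hp
  have : IsFiniteMeasure (D.withDensity fun x => ENNReal.ofReal ((-h) x)) :=
    isFiniteMeasure_withDensity hn
  have hmp : Measurable fun x => ENNReal.ofReal (h x) := hm.ennreal_ofReal
  have hmn : Measurable fun x => ENNReal.ofReal ((-h) x) := hm.neg.ennreal_ofReal
  have hexp : ∀ w : Input d, Continuous fun x : Input d =>
      Complex.exp (inner ℝ x w * Complex.I) := fun w => by fun_prop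
  have hint : ∀ (w : Input d) (g : Input d → ℝ), Integrable g D → Integrable (fun x =>
      (ENNReal.ofReal (g x)).toReal • Complex.exp (inner ℝ x w * Complex.I)) D := by
    intro w g hg
    have h1 : Integrable (fun x => (((ENNReal.ofReal (g x)).toReal : ℝ) : ℂ)) D := by
      simp only [ENNReal.toReal_ofReal']
      exact hg.pos_part.ofReal
    simp only [Complex.real_smul]
    refine h1.mul_bdd (c := 1) (hexp w).aestronglyMeasurable (Filter.Eventually.of_forall fun x => ?_)
    rw [Complex.norm_exp_ofReal_mul_I]
  have heq : D.withDensity (fun x => ENNReal.ofReal (h x))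
      = D.withDensity fun x => ENNReal.ofReal ((-h) x) := by
    refine Measure.ext_of_charFun ?_
    funext w
    rw [charFun_apply, charFun_apply,
      integral_withDensity_eq_integral_toReal_smul hmp (by simp),
      integral_withDensity_eq_integral_toReal_smul hmn (by simp), ← sub_eq_zero,
      ← integral_sub (hint w h hh) (hint w (-h) hh.neg), ← horth w]
    refine integral_congr_ae (Filter.Eventually.of_forall fun x => ?_)
    simp only [ENNReal.toReal_ofReal', Complex.real_smul, ← sub_mul, Pi.neg_apply]
    rw [← Complex.ofReal_sub]
    congr 2
    rcases le_total 0 (h x) with h0 | h0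
    · rw [max_eq_left h0, max_eq_right (by linarith)]; ring
    · rw [max_eq_right h0, max_eq_left (by linarith)]; ring
  have hae := (withDensity_eq_iff hmp.aemeasurable hmn.aemeasurable hp).1 heq
  filter_upwards [hae] with x hx
  have h1 := congrArg ENNReal.toReal hx
  simp only [ENNReal.toReal_ofReal', Pi.neg_apply] at h1
  rcases le_total 0 (h x) with h0 | h0
  · rw [max_eq_left h0, max_eq_right (by linarith)] at h1; exact h1
  · rw [max_eq_right h0, max_eq_left (by linarith)] at h1
    simp only [Pi.zero_apply]; linarith

theorem ae_eq_zero_of_integral_mul_eq_zero [IsFiniteMeasure D] (hK : IsCompact K) (hD : D Kᶜ = 0)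
    (hv : ∀ x ∈ K, inner ℝ v x = 1) (hσ : LipschitzWith Lσ σ)
    (hpoly : ¬ ∃ p : Polynomial ℝ, ∀ s : ℝ, σ s = p.eval s) (hm : Measurable h)
    (hh : Integrable h D) (horth : ∀ w, ∫ x, h x * σ (inner ℝ w x) ∂D = 0) : h =ᵐ[D] 0 :=
  ae_eq_zero_of_integral_mul_cexp_eq_zero hm hh <| integral_mul_cexp_eq_zero hK hD hh <|
    integral_mul_pow_eq_zero hK hD hv hσ hpoly hh horth

end Annihilator

/-! ### Density of finite networks in `L²(D)`. -/

section Density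

variable {σ : ℝ → ℝ} {Lσ : ℝ≥0} {d : ℕ} {D : Measure (Input d)} {K : Set (Input d)}
  {v : Input d}

theorem memLp_of_continuous [IsFiniteMeasure D] (hK : IsCompact K) (hD : D Kᶜ = 0)
    {g : Input d → ℝ} (hg : Continuous g) : MemLp g 2 D := by
  obtain ⟨B, -, hB⟩ := exists_ae_bound hK hD hg
  exact MemLp.of_bound hg.aestronglyMeasurable B hB

/-- Finite two-layer networks with a non-polynomial Lipschitz activation are dense in `L²(D)`. -/
theorem exists_finsupp_sqSeminorm_lt [IsFiniteMeasure D] (hK : IsCompact K) (hD : D Kᶜ = 0)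
    (hv : ∀ x ∈ K, inner ℝ v x = 1) (hσ : LipschitzWith Lσ σ)
    (hpoly : ¬ ∃ p : Polynomial ℝ, ∀ s : ℝ, σ s = p.eval s) {f : Input d → ℝ} (hf : Continuous f)
    {ε : ℝ} (hε : 0 < ε) :
    ∃ c : Input d →₀ ℝ,
      sqSeminorm D (fun x => (c.sum fun u b => b * σ (inner ℝ u x)) - f x) < ε := by
  have hcw : ∀ w : Input d, Continuous fun x : Input d => σ (inner ℝ w x) := fun w =>
    hσ.continuous.comp (by fun_prop)
  have hmw : ∀ w : Input d, MemLp (fun x : Input d => σ (inner ℝ w x)) 2 D := fun w =>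
    memLp_of_continuous hK hD (hcw w)
  have hmf : MemLp f 2 D := memLp_of_continuous hK hD hf
  set V : Submodule ℝ (Lp ℝ 2 D) := Submodule.span ℝ (Set.range fun w => (hmw w).toLp) with hV
  -- In a Hilbert space a subspace is dense as soon as its orthogonal complement is trivial.
  have hdense : V.topologicalClosure = ⊤ := by
    rw [Submodule.topologicalClosure_eq_top_iff, Submodule.eq_bot_iff]
    intro h hh
    rw [Submodule.mem_orthogonal] at hh
    have hint : Integrable h D := (Lp.memLp h).integrable (by norm_num)
    have h0 := ae_eq_zero_of_integral_mul_eq_zero hK hD hv hσ hpoly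
      (Lp.stronglyMeasurable h).measurable hint fun w => by
        have h1 := hh _ (Submodule.subset_span ⟨w, rfl⟩)
        rw [L2.inner_def] at h1
        rw [← h1]
        refine integral_congr_ae ?_
        filter_upwards [(hmw w).coeFn_toLp] with x hx
        simp [hx]
    exact (Lp.eq_zero_iff_ae_eq_zero).2 h0
  have hrep : ∀ s ∈ V, ∃ c : Input d →₀ ℝ, s =ᵐ[D] fun x => c.sum fun u b => b * σ (inner ℝ u x) := by
    intro s hs
    induction hs using Submodule.span_induction with
    | mem s hs =>
      obtain ⟨w, rfl⟩ := hs
      refine ⟨Finsupp.single w 1, ?_⟩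
      filter_upwards [(hmw w).coeFn_toLp] with x hx
      simp [hx]
    | zero => exact ⟨0, by filter_upwards [Lp.coeFn_zero ℝ 2 D] with x hx; exact hx.trans (by simp)⟩
    | add s t _ _ hs ht =>
      obtain ⟨c, hc⟩ := hs
      obtain ⟨e, he⟩ := ht
      refine ⟨c + e, ?_⟩
      filter_upwards [hc, he, Lp.coeFn_add s t] with x h1 h2 h3
      rw [h3, Pi.add_apply, h1, h2, Finsupp.sum_add_index' (by simp) (by intros; ring)]
    | smul a s _ hs =>
      obtain ⟨c, hc⟩ := hs
      refine ⟨a • c, ?_⟩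
      filter_upwards [hc, Lp.coeFn_smul a s] with x h1 h2
      rw [h2, Pi.smul_apply, h1, Finsupp.sum_smul_index' (by simp), smul_eq_mul, Finsupp.mul_sum]
      simp [mul_assoc]
  have hmem : hmf.toLp ∈ closure (V : Set (Lp ℝ 2 D)) := by
    rw [← Submodule.topologicalClosure_coe, hdense]
    trivial
  obtain ⟨s, hsV, hs⟩ := Metric.mem_closure_iff.1 hmem (√ε) (Real.sqrt_pos.2 hε)
  obtain ⟨c, hc⟩ := hrep s hsV
  refine ⟨c, ?_⟩
  have h1 : sqSeminorm D (fun x => (c.sum fun u b => b * σ (inner ℝ u x)) - f x)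
      = ‖s - hmf.toLp‖ ^ 2 := by
    rw [← real_inner_self_eq_norm_sq, L2.inner_def]
    refine integral_congr_ae ?_
    filter_upwards [hc, hmf.coeFn_toLp, Lp.coeFn_sub s hmf.toLp] with x h1 h2 h3
    rw [h3, Pi.sub_apply, h1, h2, real_inner_self_eq_norm_sq, Real.norm_eq_abs, sq_abs]
  rw [h1, ← dist_eq_norm, dist_comm]
  calc dist hmf.toLp s ^ 2 < √ε ^ 2 := pow_lt_pow_left₀ hs dist_nonneg two_ne_zero
    _ = ε := Real.sq_sqrt hε.le

end Density

/-! ### High-probability events. -/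

section Probability

theorem WithProbAtLeast.and {Ω : Type*} [MeasurableSpace Ω] {μ : Measure Ω} [IsProbabilityMeasure μ]
    {δ₁ δ₂ : ℝ} {P Q : Ω → Prop} (hP : WithProbAtLeast μ (1 - δ₁) P)
    (hQ : WithProbAtLeast μ (1 - δ₂) Q) :
    WithProbAtLeast μ (1 - (δ₁ + δ₂)) fun ω => P ω ∧ Q ω := by
  obtain ⟨E, hE, hE1, hE2⟩ := hP
  obtain ⟨F, hF, hF1, hF2⟩ := hQ
  refine ⟨E ∩ F, hE.inter hF, ?_, fun ω hω => ⟨hE2 ω hω.1, hF2 ω hω.2⟩⟩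
  rw [← ofReal_measureReal, ENNReal.ofReal_le_ofReal_iff measureReal_nonneg] at hE1 hF1 ⊢
  have h1 := measureReal_union_add_inter (μ := μ) (s := E) hF
  have h2 : μ.real (E ∪ F) ≤ 1 := measureReal_le_one
  linarith

theorem WithProbAtLeast.mono {Ω : Type*} [MeasurableSpace Ω] {μ : Measure Ω} {p : ℝ}
    {P Q : Ω → Prop} (hP : WithProbAtLeast μ p P) (h : ∀ ω, P ω → Q ω) :
    WithProbAtLeast μ p Q := by
  obtain ⟨E, hE, hE1, hE2⟩ := hP
  exact ⟨E, hE, hE1, fun ω hω => h ω (hE2 ω hω)⟩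

/-- Markov's inequality for the squared seminorm of a random function. -/
theorem withProbAtLeast_sqSeminorm_le {Ω : Type*} [MeasurableSpace Ω] {μ : Measure Ω}
    [IsProbabilityMeasure μ] {d : ℕ} {D : Measure (Input d)} [IsProbabilityMeasure D]
    {Φ : Ω → Input d → ℝ} (hΦ : Measurable (Function.uncurry Φ)) {V η δ : ℝ} (hη : 0 < η)
    (hδ : 0 ≤ δ) (hint : ∀ᵐ x ∂D, Integrable (fun ω => Φ ω x ^ 2) μ)
    (hV : ∀ᵐ x ∂D, ∫ ω, Φ ω x ^ 2 ∂μ ≤ V) (hVη : V ≤ η * δ) :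
    WithProbAtLeast μ (1 - δ) fun ω => sqSeminorm D (Φ ω) ≤ η := by
  have hm : Measurable (Function.uncurry fun ω x => ENNReal.ofReal (Φ ω x ^ 2)) :=
    (hΦ.pow_const 2).ennreal_ofReal
  set I : Ω → ℝ≥0∞ := fun ω => ∫⁻ x, ENNReal.ofReal (Φ ω x ^ 2) ∂D with hI
  have hIm : Measurable I := hm.lintegral_prod_right
  have hset : MeasurableSet {ω | ENNReal.ofReal η ≤ I ω} := measurableSet_le measurable_const hIm
  have htot : ∫⁻ ω, I ω ∂μ ≤ ENNReal.ofReal (η * δ) := by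
    rw [hI, lintegral_lintegral_swap hm.aemeasurable]
    calc ∫⁻ x, ∫⁻ ω, ENNReal.ofReal (Φ ω x ^ 2) ∂μ ∂D
        ≤ ∫⁻ _, ENNReal.ofReal (η * δ) ∂D := by
          refine lintegral_mono_ae ?_
          filter_upwards [hint, hV] with x h1 h2
          rw [← ofReal_integral_eq_lintegral_ofReal h1
            (Filter.Eventually.of_forall fun _ => sq_nonneg _)]
          exact ENNReal.ofReal_le_ofReal (h2.trans hVη)
      _ = ENNReal.ofReal (η * δ) := by simp
  have hbad : μ {ω | ENNReal.ofReal η ≤ I ω} ≤ ENNReal.ofReal δ := by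
    refine (meas_ge_le_lintegral_div hIm.aemeasurable (by simpa using hη)
      ENNReal.ofReal_ne_top).trans ?_
    refine ENNReal.div_le_of_le_mul (htot.trans_eq ?_)
    rw [mul_comm, ENNReal.ofReal_mul hδ]
  refine ⟨{ω | ENNReal.ofReal η ≤ I ω}ᶜ, hset.compl, ?_, fun ω hω => ?_⟩
  · rw [prob_compl_eq_one_sub hset, ENNReal.ofReal_sub _ hδ, ENNReal.ofReal_one]
    exact tsub_le_tsub_left hbad 1
  · have h1 : I ω < ENNReal.ofReal η := by simpa using hω
    have h2 : Measurable (Φ ω) := hΦ.comp measurable_prodMk_left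
    simp only [sqSeminorm]
    rw [integral_eq_lintegral_of_nonneg_ae (Filter.Eventually.of_forall fun _ => sq_nonneg _)
      (h2.pow_const 2).aestronglyMeasurable]
    exact ENNReal.toReal_le_of_le_ofReal hη.le h1.le

end Probability

/-! ### Laws, independence and moments of the initial neurons. -/

section Initialization

variable {m d : ℕ}

/-- The law of a single coordinate of the Gaussian initialization. -/
noncomputable def coordLaw (m d : ℕ) (k : (Fin m × Fin d) ⊕ Fin m) : Measure ℝ :=
  Sum.elim (fun _ => gaussianReal 0 1) (fun _ => gaussianReal 0 (1 / (m : ℝ≥0))) k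

instance (k : (Fin m × Fin d) ⊕ Fin m) : IsProbabilityMeasure (coordLaw m d k) := by
  cases k <;> simp only [coordLaw, Sum.elim_inl, Sum.elim_inr] <;> infer_instance

theorem initMeasure_eq (m d : ℕ) :
    initMeasure m d = (Measure.pi (coordLaw m d)).map (WithLp.toLp 2) := rfl

instance : IsProbabilityMeasure (initMeasure m d) := by
  rw [initMeasure_eq]
  exact Measure.isProbabilityMeasure_map (by fun_prop)

theorem measurable_coord (k : (Fin m × Fin d) ⊕ Fin m) : Measurable fun θ : Param m d => θ k := by
  fun_prop

theorem map_ofLp_initMeasure :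
    (initMeasure m d).map (fun θ k => θ k) = Measure.pi (coordLaw m d) := by
  rw [initMeasure_eq, Measure.map_map (by fun_prop) (by fun_prop)]
  exact Measure.map_id

theorem map_coord_initMeasure (k : (Fin m × Fin d) ⊕ Fin m) :
    (initMeasure m d).map (fun θ => θ k) = coordLaw m d k := by
  rw [← (measurePreserving_eval (coordLaw m d) k).map_eq, ← map_ofLp_initMeasure,
    Measure.map_map (by fun_prop) (by fun_prop)]
  rfl

theorem iIndepFun_coord :
    iIndepFun (fun (k : (Fin m × Fin d) ⊕ Fin m) (θ : Param m d) => θ k) (initMeasure m d) := by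
  rw [iIndepFun_iff_map_fun_eq_pi_map fun k => (measurable_coord k).aemeasurable]
  simp_rw [map_coord_initMeasure]
  exact map_ofLp_initMeasure

theorem map_w_initMeasure (i : Fin m) :
    (initMeasure m d).map (fun θ => θ.w i) = stdGaussian (Input d) := by
  have hinj : Function.Injective fun j : Fin d => (Sum.inl (i, j) : (Fin m × Fin d) ⊕ Fin m) := by
    intro j j' h
    simpa using h
  have h1 := (iIndepFun_iff_map_fun_eq_pi_map fun j =>
    (measurable_coord (Sum.inl (i, j))).aemeasurable).1 ((iIndepFun_coord (m := m)).precomp hinj)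
  simp_rw [map_coord_initMeasure] at h1
  have h2 : (fun θ : Param m d => θ.w i)
      = WithLp.toLp 2 ∘ fun (θ : Param m d) (j : Fin d) => θ (Sum.inl (i, j)) := rfl
  rw [h2, ← Measure.map_map (by fun_prop) (by fun_prop), h1]
  exact map_pi_eq_stdGaussian

theorem map_a_initMeasure (i : Fin m) :
    (initMeasure m d).map (fun θ => θ.a i) = gaussianReal 0 (1 / (m : ℝ≥0)) :=
  map_coord_initMeasure (Sum.inr i)

/-- The coordinates of the parameters of the `i`-th neuron. -/
def block (m d : ℕ) (i : Fin m) : Finset ((Fin m × Fin d) ⊕ Fin m) :=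
  Finset.univ.filter fun k => Sum.elim Prod.fst id k = i

theorem indepFun_neuron {i j : Fin m} (hij : i ≠ j) :
    IndepFun (fun θ : Param m d => (θ.w i, θ.a i)) (fun θ : Param m d => (θ.w j, θ.a j))
      (initMeasure m d) := by
  have hdisj : Disjoint (block m d i) (block m d j) := by
    rw [Finset.disjoint_left]
    intro k hk hk'
    simp only [block, Finset.mem_filter, Finset.mem_univ, true_and] at hk hk'
    exact hij (hk.symm.trans hk')
  have h := (iIndepFun_coord (m := m) (d := d)).indepFun_finset _ _ hdisj measurable_coord
  have hproj : ∀ i : Fin m, Measurable fun y : block m d i → ℝ =>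
      ((WithLp.toLp 2 fun j' => y ⟨Sum.inl (i, j'), by simp [block]⟩ : Input d),
        y ⟨Sum.inr i, by simp [block]⟩) := fun i => by fun_prop
  exact h.comp (hproj i) (hproj j)

theorem indepFun_a_w (i : Fin m) :
    IndepFun (fun θ : Param m d => θ.a i) (fun θ : Param m d => θ.w i) (initMeasure m d) := by
  classical
  have hdisj : Disjoint ({Sum.inr i} : Finset ((Fin m × Fin d) ⊕ Fin m))
      (Finset.univ.image Sum.inl) := by
    simp
  have h := (iIndepFun_coord (m := m) (d := d)).indepFun_finset _ _ hdisj measurable_coord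
  have h1 : Measurable fun y : ({Sum.inr i} : Finset ((Fin m × Fin d) ⊕ Fin m)) → ℝ =>
      y ⟨Sum.inr i, by simp⟩ := by fun_prop
  have h2 : Measurable fun y : ((Finset.univ.image Sum.inl :
      Finset ((Fin m × Fin d) ⊕ Fin m))) → ℝ =>
      (WithLp.toLp 2 fun j' => y ⟨Sum.inl (i, j'), by simp⟩ : Input d) := by fun_prop
  exact h.comp h1 h2

theorem measurable_w (i : Fin m) : Measurable fun θ : Param m d => θ.w i :=
  (Param.continuous_w i).measurable

theorem measurable_a (i : Fin m) : Measurable fun θ : Param m d => θ.a i :=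
  (Param.continuous_a i).measurable

theorem integral_w {φ : Input d → ℝ} (hφ : Measurable φ) (i : Fin m) :
    ∫ θ, φ (θ.w i) ∂(initMeasure m d) = ∫ w, φ w ∂(stdGaussian (Input d)) := by
  rw [← map_w_initMeasure i, integral_map (measurable_w i).aemeasurable
    hφ.aestronglyMeasurable]

theorem integral_a (i : Fin m) : ∫ θ, θ.a i ∂(initMeasure m d) = 0 := by
  have h := integral_map (μ := initMeasure m d) (measurable_a i).aemeasurable
    (f := fun x : ℝ => x) (by fun_prop)
  rw [← h, map_a_initMeasure]
  simp

theorem memLp_a (i : Fin m) : MemLp (fun θ : Param m d => θ.a i) 2 (initMeasure m d) := by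
  have h : MemLp id 2 ((initMeasure m d).map fun θ => θ.a i) := by
    rw [map_a_initMeasure]
    exact IsGaussian.memLp_two_id
  exact (memLp_map_measure_iff (by fun_prop) (measurable_a i).aemeasurable).1 h

theorem integral_a_sq (i : Fin m) : ∫ θ, θ.a i ^ 2 ∂(initMeasure m d) = 1 / m := by
  have h := integral_map (μ := initMeasure m d) (measurable_a i).aemeasurable
    (f := fun x : ℝ => x ^ 2) (by fun_prop)
  rw [← h, map_a_initMeasure]
  have h2 := variance_of_integral_eq_zero (X := id) (μ := gaussianReal 0 (1 / (m : ℝ≥0)))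
    (by fun_prop) (by simp)
  rw [variance_id_gaussianReal] at h2
  simpa using h2.symm

/-- Second moment bound for a centred sum over independent neurons. -/
theorem integral_sq_sum_sub_le {ψ : Input d × ℝ → ℝ} (hψ : Measurable ψ)
    (hL2 : ∀ i : Fin m, MemLp (fun θ : Param m d => ψ (θ.w i, θ.a i)) 2 (initMeasure m d))
    {V : ℝ} (hV : ∀ i : Fin m, ∫ θ : Param m d, ψ (θ.w i, θ.a i) ^ 2 ∂(initMeasure m d) ≤ V) :
    ∫ θ : Param m d, (∑ i, ψ (θ.w i, θ.a i)
      - ∑ i : Fin m, ∫ θ' : Param m d, ψ (θ'.w i, θ'.a i) ∂(initMeasure m d)) ^ 2 ∂(initMeasure m d)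
      ≤ m * V := by
  have hvar := IndepFun.variance_sum (μ := initMeasure m d) (s := Finset.univ)
    (X := fun (i : Fin m) (θ : Param m d) => ψ (θ.w i, θ.a i)) (fun i _ => hL2 i)
    (fun i _ j _ hij => (indepFun_neuron hij).comp hψ hψ)
  rw [variance_eq_integral (Finset.aemeasurable_sum _ fun i _ =>
    (hL2 i).aestronglyMeasurable.aemeasurable)] at hvar
  have hmean : ∫ θ : Param m d, (∑ i : Fin m, fun θ : Param m d => ψ (θ.w i, θ.a i)) θ ∂(initMeasure m d)
      = ∑ i : Fin m, ∫ θ' : Param m d, ψ (θ'.w i, θ'.a i) ∂(initMeasure m d) := by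
    simp only [Finset.sum_apply]
    exact integral_finsetSum _ fun i _ => (hL2 i).integrable (by norm_num)
  rw [hmean] at hvar
  simp only [Finset.sum_apply] at hvar
  rw [hvar]
  calc ∑ i : Fin m, Var[fun θ : Param m d => ψ (θ.w i, θ.a i); initMeasure m d]
      ≤ ∑ _ : Fin m, V := Finset.sum_le_sum fun i _ =>
        (variance_le_expectation_sq (hL2 i).aestronglyMeasurable).trans (hV i)
    _ = m * V := by simp

end Initialization

/-! ### Infinitely wide networks with bounded density. -/

section GaussianRepresentation

variable {σ : ℝ → ℝ} {Lσ : ℝ≥0} {d : ℕ} {D : Measure (Input d)} {K : Set (Input d)} {v : Input d}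
  {f : Input d → ℝ}

/-- Balls get positive mass, so their indicators can be normalized. -/
instance : (stdGaussian (Input d)).IsOpenPosMeasure := by
  have : (gaussianReal 0 1).IsOpenPosMeasure :=
    (gaussianReal_absolutelyContinuous' 0 one_ne_zero).isOpenPosMeasure
  rw [← map_pi_eq_stdGaussian]
  exact (by fun_prop : Continuous (WithLp.toLp 2 : (Fin d → ℝ) → Input d)).isOpenPosMeasure_map
    (WithLp.toLp_surjective 2)

theorem sqSeminorm_sub_le_of_ae_abs_sub_le [IsProbabilityMeasure D] {p q : Input d → ℝ} {τ : ℝ}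
    (hpq : ∀ᵐ x ∂D, |p x - q x| ≤ τ) (hq : Integrable (fun x => (q x - f x) ^ 2) D) :
    sqSeminorm D (fun x => p x - f x) ≤ 2 * τ ^ 2 + 2 * sqSeminorm D (fun x => q x - f x) := by
  unfold sqSeminorm
  have h1 : ∫ x, (2 * τ ^ 2 + 2 * (q x - f x) ^ 2) ∂D = 2 * τ ^ 2 + 2 * ∫ x, (q x - f x) ^ 2 ∂D := by
    rw [integral_add (integrable_const _) (hq.const_mul 2), integral_const, integral_const_mul]
    simp
  rw [← h1]
  refine integral_mono_of_nonneg (Filter.Eventually.of_forall fun _ => sq_nonneg _)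
    ((integrable_const _).add (hq.const_mul 2)) ?_
  filter_upwards [hpq] with x hx
  have h2 : (p x - q x) ^ 2 ≤ τ ^ 2 := sq_le_sq' (by linarith [neg_abs_le (p x - q x)])
    ((le_abs_self _).trans hx)
  nlinarith [sq_nonneg ((p x - q x) - (q x - f x))]

theorem sqSeminorm_sub_le {p q : Input d → ℝ}
    (hp : Integrable (fun x => (p x - q x) ^ 2) D) (hq : Integrable (fun x => (q x - f x) ^ 2) D) :
    sqSeminorm D (fun x => p x - f x)
      ≤ 2 * sqSeminorm D (fun x => p x - q x) + 2 * sqSeminorm D (fun x => q x - f x) := by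
  unfold sqSeminorm
  rw [← integral_const_mul, ← integral_const_mul,
    ← integral_add (hp.const_mul 2) (hq.const_mul 2)]
  refine integral_mono_of_nonneg (Filter.Eventually.of_forall fun _ => sq_nonneg _)
    ((hp.const_mul 2).add (hq.const_mul 2)) (Filter.Eventually.of_forall fun x => ?_)
  simp only
  nlinarith [sq_nonneg ((p x - q x) - (q x - f x))]

theorem continuous_activation (hσ : Continuous σ) (x : Input d) :
    Continuous fun w : Input d => σ (inner ℝ w x) := hσ.comp (by fun_prop)

theorem stronglyMeasurable_integral_activation (hσ : Continuous σ) {g : Input d → ℝ}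
    (hg : Measurable g) : StronglyMeasurable fun x : Input d =>
      ∫ w, g w * σ (inner ℝ w x) ∂(stdGaussian (Input d)) := by
  refine StronglyMeasurable.integral_prod_right
    (f := fun (x w : Input d) => g w * σ (inner ℝ w x)) ?_
  refine ((hg.comp measurable_snd).mul ?_).stronglyMeasurable
  exact (by fun_prop : Continuous fun p : Input d × Input d => σ (inner ℝ p.2 p.1)).measurable

/-- The normalized indicator function of the ball of radius `r` around `u`. -/
noncomputable def ballDensity (r : ℝ) (u w : Input d) : ℝ :=
  (Metric.ball u r).indicator (fun _ => ((stdGaussian (Input d)).real (Metric.ball u r))⁻¹) w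

theorem measurable_ballDensity (r : ℝ) (u : Input d) : Measurable (ballDensity r u) :=
  measurable_const.indicator Metric.isOpen_ball.measurableSet

theorem abs_ballDensity_le (r : ℝ) (u w : Input d) :
    |ballDensity r u w| ≤ ((stdGaussian (Input d)).real (Metric.ball u r))⁻¹ := by
  have h0 : 0 ≤ ((stdGaussian (Input d)).real (Metric.ball u r))⁻¹ := by positivity
  unfold ballDensity
  by_cases hw : w ∈ Metric.ball u r
  · rw [Set.indicator_of_mem hw, abs_of_nonneg h0]
  · rw [Set.indicator_of_notMem hw, abs_zero]
    exact h0

theorem abs_ballDensity_mul_le (hσ : LipschitzWith Lσ σ) {r B : ℝ} {x : Input d}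
    (hx : ‖x‖ ≤ B) (u w : Input d) :
    |ballDensity r u w * σ (inner ℝ w x)|
      ≤ ((stdGaussian (Input d)).real (Metric.ball u r))⁻¹ * (|σ 0| + Lσ * ((‖u‖ + |r|) * B)) := by
  have hB : 0 ≤ B := (norm_nonneg _).trans hx
  by_cases hw : w ∈ Metric.ball u r
  · rw [abs_mul]
    have hwn : ‖w‖ ≤ ‖u‖ + |r| := by
      have h1 := norm_le_norm_add_norm_sub' w u
      have h2 := Metric.mem_ball.1 hw
      rw [dist_eq_norm] at h2
      linarith [le_abs_self r]
    refine mul_le_mul (abs_ballDensity_le r u w) ((hσ.abs_le _).trans ?_) (abs_nonneg _)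
      (by positivity)
    gcongr
    exact (abs_real_inner_le_norm _ _).trans (mul_le_mul hwn hx (norm_nonneg _) (by positivity))
  · rw [ballDensity, Set.indicator_of_notMem hw, zero_mul, abs_zero]
    positivity

theorem integrable_ballDensity_mul (hσ : LipschitzWith Lσ σ) (r : ℝ) (u x : Input d) :
    Integrable (fun w => ballDensity r u w * σ (inner ℝ w x)) (stdGaussian (Input d)) :=
  Integrable.of_bound (((measurable_ballDensity r u).mul
    (continuous_activation hσ.continuous x).measurable).aestronglyMeasurable) _
    (Filter.Eventually.of_forall fun w => abs_ballDensity_mul_le hσ le_rfl u w)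

/-- Spreading a single neuron over a small ball around its weight costs at most the oscillation of
the activation there, and replaces a point mass by a bounded density. -/
theorem abs_integral_ballDensity_mul_sub_le (hσ : LipschitzWith Lσ σ) {r B : ℝ} (hr : 0 < r)
    {x : Input d} (hx : ‖x‖ ≤ B) (u : Input d) :
    |∫ w, ballDensity r u w * σ (inner ℝ w x) ∂(stdGaussian (Input d)) - σ (inner ℝ u x)|
      ≤ Lσ * (r * B) := by
  set ν := stdGaussian (Input d)
  have hpos : 0 < ν.real (Metric.ball u r) := by
    rw [measureReal_def]
    exact ENNReal.toReal_pos (Metric.isOpen_ball.measure_pos ν (Metric.nonempty_ball.2 hr)).ne'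
      (measure_ne_top _ _)
  have hint1 : Integrable (ballDensity r u) ν :=
    Integrable.of_bound (measurable_ballDensity r u).aestronglyMeasurable _
      (Filter.Eventually.of_forall fun w => abs_ballDensity_le r u w)
  have hone : ∫ w, ballDensity r u w ∂ν = 1 := by
    unfold ballDensity
    rw [integral_indicator_const _ Metric.isOpen_ball.measurableSet, smul_eq_mul,
      mul_inv_cancel₀ hpos.ne']
  have h1 : ∫ w, ballDensity r u w * σ (inner ℝ w x) ∂ν - σ (inner ℝ u x)
      = ∫ w, ballDensity r u w * (σ (inner ℝ w x) - σ (inner ℝ u x)) ∂ν := by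
    simp_rw [mul_sub]
    rw [integral_sub (integrable_ballDensity_mul hσ r u x) (hint1.mul_const _),
      integral_mul_const, hone, one_mul]
  have h0 : ∀ w, 0 ≤ ballDensity r u w := fun w =>
    Set.indicator_nonneg (fun _ _ => inv_nonneg.2 hpos.le) w
  rw [h1]
  calc |∫ w, ballDensity r u w * (σ (inner ℝ w x) - σ (inner ℝ u x)) ∂ν|
      ≤ ∫ w, ballDensity r u w * (Lσ * (r * B)) ∂ν := by
        refine (Real.norm_eq_abs _ ▸ norm_integral_le_of_norm_le (hint1.mul_const _)
          (Filter.Eventually.of_forall fun w => ?_))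
        rw [norm_mul, Real.norm_of_nonneg (h0 w)]
        by_cases hw : w ∈ Metric.ball u r
        · refine mul_le_mul_of_nonneg_left ((hσ.abs_sub_le _ _).trans ?_) (h0 w)
          rw [← inner_sub_left]
          gcongr
          refine (abs_real_inner_le_norm _ _).trans (mul_le_mul ?_ hx (norm_nonneg _) hr.le)
          rw [← dist_eq_norm]
          exact (Metric.mem_ball.1 hw).le
        · rw [ballDensity, Set.indicator_of_notMem hw, zero_mul, zero_mul]
    _ = Lσ * (r * B) := by rw [integral_mul_const, hone, one_mul]

/-- Approximation in `L²(D)` by infinitely wide networks with bounded output density with respect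
to the Gaussian law of the hidden weights. -/
theorem exists_density_approx [IsProbabilityMeasure D] (hK : IsCompact K) (hD : D Kᶜ = 0)
    (hv : ∀ x ∈ K, inner ℝ v x = 1) (hσ : LipschitzWith Lσ σ)
    (hpoly : ¬ ∃ p : Polynomial ℝ, ∀ s : ℝ, σ s = p.eval s) (hf : Continuous f)
    {B : ℝ} (hB : 0 ≤ B) (hBD : ∀ᵐ x : Input d ∂D, ‖x‖ ≤ B) {ε : ℝ} (hε : 0 < ε) :
    ∃ (g : Input d → ℝ) (G C : ℝ), Measurable g ∧ (∀ w, |g w| ≤ G) ∧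
      (∀ x : Input d, ‖x‖ ≤ B → ∀ w, |g w * σ (inner ℝ w x)| ≤ C) ∧
      sqSeminorm D (fun x => ∫ w, g w * σ (inner ℝ w x) ∂(stdGaussian (Input d)) - f x) ≤ ε := by
  obtain ⟨c, hc⟩ := exists_finsupp_sqSeminorm_lt hK hD hv hσ hpoly hf (ε := ε / 4) (by positivity)
  set S : ℝ := ∑ u ∈ c.support, |c u| with hS
  have hS0 : 0 ≤ S := Finset.sum_nonneg fun _ _ => abs_nonneg _
  -- The radius makes the total smearing error at most `√(ε / 4)`; the `+ 1` avoids a zero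
  -- denominator. The two errors then give `2 · ε/4 + 2 · ε/4`.
  set r : ℝ := √(ε / 4) / (S * (Lσ * B) + 1) with hr
  have hr0 : 0 < r := by positivity
  have hrS : S * (Lσ * (r * B)) ≤ √(ε / 4) := by
    have h1 : S * (Lσ * (r * B)) = √(ε / 4) * ((S * (Lσ * B)) / (S * (Lσ * B) + 1)) := by
      rw [hr]; ring
    rw [h1]
    refine mul_le_of_le_one_right (Real.sqrt_nonneg _) ?_
    rw [div_le_one (by positivity)]
    linarith
  set ν := stdGaussian (Input d)
  refine ⟨fun w => ∑ u ∈ c.support, c u * ballDensity r u w,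
    ∑ u ∈ c.support, |c u| * (ν.real (Metric.ball u r))⁻¹,
    ∑ u ∈ c.support, |c u| * ((ν.real (Metric.ball u r))⁻¹ * (|σ 0| + Lσ * ((‖u‖ + |r|) * B))),
    ?_, ?_, ?_, ?_⟩
  · exact Finset.measurable_fun_sum _ fun u _ => (measurable_ballDensity r u).const_mul _
  · intro w
    refine (Finset.abs_sum_le_sum_abs _ _).trans (Finset.sum_le_sum fun u _ => ?_)
    rw [abs_mul]
    exact mul_le_mul_of_nonneg_left (abs_ballDensity_le r u w) (abs_nonneg _)
  · intro x hx w
    rw [Finset.sum_mul]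
    refine (Finset.abs_sum_le_sum_abs _ _).trans (Finset.sum_le_sum fun u _ => ?_)
    rw [mul_assoc, abs_mul]
    exact mul_le_mul_of_nonneg_left (abs_ballDensity_mul_le hσ hx u w) (abs_nonneg _)
  · have hcont : Continuous fun x : Input d => (c.sum fun u b => b * σ (inner ℝ u x)) := by
      unfold Finsupp.sum
      have := hσ.continuous
      fun_prop
    refine (sqSeminorm_sub_le_of_ae_abs_sub_le (τ := √(ε / 4))
      (q := fun x => c.sum fun u b => b * σ (inner ℝ u x)) ?_
      (integrable_of_continuous hK hD (by fun_prop))).trans ?_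
    · filter_upwards [hBD] with x hx
      refine le_trans ?_ hrS
      have h1 : ∫ w, (∑ u ∈ c.support, c u * ballDensity r u w) * σ (inner ℝ w x) ∂ν
          = ∑ u ∈ c.support, c u * ∫ w, ballDensity r u w * σ (inner ℝ w x) ∂ν := by
        simp_rw [Finset.sum_mul, mul_assoc]
        rw [integral_finsetSum _ fun u _ => (integrable_ballDensity_mul hσ r u x).const_mul _]
        simp_rw [integral_const_mul]
        rfl
      rw [h1, Finsupp.sum, ← Finset.sum_sub_distrib, hS, Finset.sum_mul]
      refine (Finset.abs_sum_le_sum_abs _ _).trans (Finset.sum_le_sum fun u _ => ?_)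
      rw [← mul_sub, abs_mul]
      exact mul_le_mul_of_nonneg_left (abs_integral_ballDensity_mul_sub_le hσ hr0 hx u)
        (abs_nonneg _)
    · rw [Real.sq_sqrt (by positivity)]
      linarith

end GaussianRepresentation

/-! ### Concentration at initialization. -/

section Events

variable {σ : ℝ → ℝ} {Lσ : ℝ≥0} {m d : ℕ} {D : Measure (Input d)} {K : Set (Input d)}
  {f : Input d → ℝ}

theorem withProbAtLeast_sum_a_sq_le [IsProbabilityMeasure D] (hm : 0 < m) {δ : ℝ} (hδ : 0 < δ) :
    WithProbAtLeast (initMeasure m d) (1 - δ) fun θ => ∑ i, θ.a i ^ 2 ≤ 1 / δ := by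
  have hcont : Continuous fun p : Param m d × Input d => √(∑ i, p.1.a i ^ 2) := by fun_prop
  have hsq : ∀ θ : Param m d, √(∑ i, θ.a i ^ 2) ^ 2 = ∑ i, θ.a i ^ 2 := fun θ =>
    Real.sq_sqrt (Finset.sum_nonneg fun _ _ => sq_nonneg _)
  have hint : ∀ i : Fin m, Integrable (fun θ : Param m d => θ.a i ^ 2) (initMeasure m d) :=
    fun i => (memLp_a i).integrable_sq
  -- A function constant in `x` turns the seminorm version of Markov's inequality into the scalar
  -- one; the expectation of the sum is `m · (1/m) = 1`.
  have h := withProbAtLeast_sqSeminorm_le (μ := initMeasure m d) (D := D)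
    (Φ := fun θ _ => √(∑ i, θ.a i ^ 2)) hcont.measurable (V := 1) (η := 1 / δ) (δ := δ)
    (by positivity) hδ.le
    (Filter.Eventually.of_forall fun x => by
      simp_rw [hsq]
      exact integrable_finsetSum _ fun i _ => hint i)
    (Filter.Eventually.of_forall fun x => by
      simp_rw [hsq]
      rw [integral_finsetSum _ fun i _ => hint i]
      simp_rw [integral_a_sq]
      have : (m : ℝ) ≠ 0 := by positivity
      simp [this])
    (by field_simp; exact le_rfl)
  refine h.mono fun θ hθ => ?_
  simp only [sqSeminorm, hsq] at hθ
  simpa using hθ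

/-- The network is an average of `m` independent terms bounded by `C` whose mean is the integral, so
its mean squared error is at most `C² / m`; then Markov. -/
theorem withProbAtLeast_average_le [IsProbabilityMeasure D] (hm : 0 < m)
    (hσ : Continuous σ) {g : Input d → ℝ} (hg : Measurable g) {B C : ℝ}
    (hBD : ∀ᵐ x : Input d ∂D, ‖x‖ ≤ B)
    (hC : ∀ x : Input d, ‖x‖ ≤ B → ∀ w, |g w * σ (inner ℝ w x)| ≤ C) {η δ : ℝ}
    (hη : 0 < η) (hδ : 0 < δ) (hmC : C ^ 2 ≤ m * (η * δ)) :
    WithProbAtLeast (initMeasure m d) (1 - δ) fun θ =>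
      sqSeminorm D (fun x => network σ (θ.withA fun i => g (θ.w i) / m) x
        - ∫ w, g w * σ (inner ℝ w x) ∂(stdGaussian (Input d))) ≤ η := by
  have hm' : (0 : ℝ) < m := by exact_mod_cast hm
  have hnet : ∀ (θ : Param m d) (x : Input d), network σ (θ.withA fun i => g (θ.w i) / m) x
      = (∑ i, g (θ.w i) * σ (inner ℝ (θ.w i) x)) / m := by
    intro θ x
    simp only [network, Param.a_withA, Param.w_withA, Finset.sum_div]
    exact Finset.sum_congr rfl fun i _ => by ring
  have hq := stronglyMeasurable_integral_activation hσ hg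
  have hY : ∀ x, Measurable fun p : Input d × ℝ => g p.1 * σ (inner ℝ p.1 x) := fun x =>
    (hg.comp measurable_fst).mul
      ((continuous_activation hσ x).measurable.comp measurable_fst)
  have hYm : ∀ x (i : Fin m), Measurable fun θ : Param m d =>
      g (θ.w i) * σ (inner ℝ (θ.w i) x) := fun x i =>
    (hY x).comp ((measurable_w i).prodMk (measurable_a i))
  have hL2 : ∀ x : Input d, ‖x‖ ≤ B → ∀ i : Fin m, MemLp (fun θ : Param m d =>
      g (θ.w i) * σ (inner ℝ (θ.w i) x)) 2 (initMeasure m d) := fun x hx i =>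
    MemLp.of_bound (hYm x i).aestronglyMeasurable C
      (Filter.Eventually.of_forall fun θ => hC x hx (θ.w i))
  refine withProbAtLeast_sqSeminorm_le (V := C ^ 2 / m) ?_ hη hδ.le ?_ ?_ ?_
  · simp_rw [hnet]
    refine Measurable.sub (Measurable.div_const (Finset.measurable_fun_sum _ fun i _ => ?_) _)
      (hq.measurable.comp measurable_snd)
    refine (hg.comp ((measurable_w i).comp measurable_fst)).mul ?_
    exact (by fun_prop : Continuous fun p : Param m d × Input d =>
      σ (inner ℝ (p.1.w i) p.2)).measurable
  · filter_upwards [hBD] with x hx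
    simp_rw [hnet]
    refine MemLp.integrable_sq (MemLp.sub ?_ (memLp_const _))
    simp_rw [div_eq_mul_inv]
    exact (memLp_finsetSum _ fun i _ => hL2 x hx i).mul_const _
  · filter_upwards [hBD] with x hx
    have h1 := integral_sq_sum_sub_le (hY x) (hL2 x hx) (V := C ^ 2) fun i => by
      have hb : ∀ θ : Param m d, (g (θ.w i) * σ (inner ℝ (θ.w i) x)) ^ 2 ≤ C ^ 2 := fun θ =>
        sq_le_sq' (by linarith [neg_abs_le (g (θ.w i) * σ (inner ℝ (θ.w i) x)), hC x hx (θ.w i)])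
          ((le_abs_self _).trans (hC x hx (θ.w i)))
      calc ∫ θ : Param m d, (g (θ.w i) * σ (inner ℝ (θ.w i) x)) ^ 2 ∂(initMeasure m d)
          ≤ ∫ _ : Param m d, C ^ 2 ∂(initMeasure m d) :=
            integral_mono (hL2 x hx i).integrable_sq (integrable_const _) hb
        _ = C ^ 2 := by simp
    simp only at h1
    have h2 : ∀ i : Fin m, ∫ θ : Param m d, g (θ.w i) * σ (inner ℝ (θ.w i) x) ∂(initMeasure m d)
        = ∫ w, g w * σ (inner ℝ w x) ∂(stdGaussian (Input d)) := fun i =>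
      integral_w (φ := fun w => g w * σ (inner ℝ w x))
        (hg.mul (continuous_activation hσ x).measurable) i
    simp_rw [h2] at h1
    set q := ∫ w, g w * σ (inner ℝ w x) ∂(stdGaussian (Input d))
    have h3 : ∀ θ : Param m d, (network σ (θ.withA fun i => g (θ.w i) / m) x - q) ^ 2
        = (∑ i, g (θ.w i) * σ (inner ℝ (θ.w i) x) - ∑ _ : Fin m, q) ^ 2 / m ^ 2 := by
      intro θ
      rw [hnet]
      simp only [Finset.sum_const, Finset.card_univ, Fintype.card_fin, nsmul_eq_mul]
      field_simp
    simp_rw [h3]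
    rw [integral_div]
    calc _ ≤ (m * C ^ 2) / (m : ℝ) ^ 2 := by gcongr
      _ = C ^ 2 / m := by field_simp
  · rw [div_le_iff₀ hm']
    linarith

theorem integrable_sq_add_norm (A C B : ℝ) :
    Integrable (fun w : Input d => (A + C * (‖w‖ * B)) ^ 2) (stdGaussian (Input d)) := by
  have h1 : MemLp (fun w : Input d => ‖w‖) 2 (stdGaussian (Input d)) :=
    (IsGaussian.memLp_two_id (μ := stdGaussian (Input d))).norm
  have h2 : MemLp (fun w : Input d => C * (‖w‖ * B)) 2 (stdGaussian (Input d)) :=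
    (h1.mul_const B).const_mul C
  have h3 : MemLp (fun _ : Input d => A) 2 (stdGaussian (Input d)) := memLp_const A
  exact (h3.add h2).integrable_sq

/-- The variance `1/m` of the output weights makes the bound free of `m`: the terms are independent
and centred with second moment at most `S / m`. -/
theorem exists_withProbAtLeast_network_le [IsProbabilityMeasure D] (hσ : LipschitzWith Lσ σ) {B : ℝ}
    (hBD : ∀ᵐ x : Input d ∂D, ‖x‖ ≤ B) {δ : ℝ} (hδ : 0 < δ) :
    ∃ M : ℝ, ∀ m : ℕ, 0 < m → WithProbAtLeast (initMeasure m d) (1 - δ) fun θ =>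
      sqSeminorm D (network σ θ) ≤ M := by
  set ν := stdGaussian (Input d)
  set S : ℝ := ∫ w, (|σ 0| + Lσ * (‖w‖ * B)) ^ 2 ∂ν with hS
  have hS0 : 0 ≤ S := integral_nonneg fun _ => sq_nonneg _
  have hSint : Integrable (fun w : Input d => (|σ 0| + Lσ * (‖w‖ * B)) ^ 2) ν :=
    integrable_sq_add_norm _ _ _
  refine ⟨(S + 1) / δ, fun m hm => ?_⟩
  have hm' : (0 : ℝ) < m := by exact_mod_cast hm
  have hσint : ∀ x : Input d, ‖x‖ ≤ B → Integrable (fun w : Input d => σ (inner ℝ w x) ^ 2) ν ∧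
      ∫ w, σ (inner ℝ w x) ^ 2 ∂ν ≤ S := by
    intro x hx
    have hb : ∀ w : Input d, σ (inner ℝ w x) ^ 2 ≤ (|σ 0| + Lσ * (‖w‖ * B)) ^ 2 := by
      intro w
      rw [← sq_abs]
      gcongr
      refine (hσ.abs_le _).trans ?_
      gcongr
      exact (abs_real_inner_le_norm _ _).trans (by gcongr)
    have hi : Integrable (fun w : Input d => σ (inner ℝ w x) ^ 2) ν :=
      hSint.mono ((continuous_activation hσ.continuous x).pow 2).aestronglyMeasurable
        (Filter.Eventually.of_forall fun w => by
          rw [Real.norm_of_nonneg (sq_nonneg _), Real.norm_of_nonneg (sq_nonneg _)]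
          exact hb w)
    exact ⟨hi, integral_mono hi hSint hb⟩
  have hmeasσ : ∀ x, Measurable fun w : Input d => σ (inner ℝ w x) := fun x =>
    (continuous_activation hσ.continuous x).measurable
  have hY : ∀ x, Measurable fun p : Input d × ℝ => p.2 * σ (inner ℝ p.1 x) := fun x =>
    measurable_snd.mul ((hmeasσ x).comp measurable_fst)
  have hsq : ∀ x : Input d, ‖x‖ ≤ B → ∀ i : Fin m,
      Integrable (fun θ : Param m d => (θ.a i * σ (inner ℝ (θ.w i) x)) ^ 2) (initMeasure m d) ∧
      ∫ θ : Param m d, (θ.a i * σ (inner ℝ (θ.w i) x)) ^ 2 ∂(initMeasure m d) ≤ S / m := by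
    intro x hx i
    have hind : IndepFun (fun θ : Param m d => θ.a i ^ 2)
        (fun θ : Param m d => σ (inner ℝ (θ.w i) x) ^ 2) (initMeasure m d) :=
      (indepFun_a_w i).comp (measurable_id.pow_const 2) ((hmeasσ x).pow_const 2)
    have hi : Integrable (fun θ : Param m d => σ (inner ℝ (θ.w i) x) ^ 2) (initMeasure m d) := by
      have h := (hσint x hx).1
      rw [show ν = (initMeasure m d).map (fun θ => θ.w i) from (map_w_initMeasure i).symm] at h
      exact h.comp_measurable (measurable_w i)
    have ha := (memLp_a (d := d) i).integrable_sq
    simp_rw [mul_pow]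
    refine ⟨hind.integrable_mul ha hi, ?_⟩
    rw [hind.integral_fun_mul_eq_mul_integral ha.aestronglyMeasurable hi.aestronglyMeasurable,
      integral_a_sq, integral_w (φ := fun w => σ (inner ℝ w x) ^ 2) ((hmeasσ x).pow_const 2)]
    calc 1 / (m : ℝ) * ∫ w, σ (inner ℝ w x) ^ 2 ∂ν ≤ 1 / (m : ℝ) * S := by
          gcongr
          exact (hσint x hx).2
      _ = S / m := by ring
  have hYm : ∀ x (i : Fin m), Measurable fun θ : Param m d =>
      θ.a i * σ (inner ℝ (θ.w i) x) := fun x i =>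
    (hY x).comp ((measurable_w i).prodMk (measurable_a i))
  have hL2 : ∀ x : Input d, ‖x‖ ≤ B → ∀ i : Fin m, MemLp (fun θ : Param m d =>
      θ.a i * σ (inner ℝ (θ.w i) x)) 2 (initMeasure m d) := fun x hx i =>
    (memLp_two_iff_integrable_sq (hYm x i).aestronglyMeasurable).2 (hsq x hx i).1
  refine withProbAtLeast_sqSeminorm_le (V := S) (continuous_network hσ.continuous).measurable
    (by positivity) hδ.le ?_ ?_ ?_
  · filter_upwards [hBD] with x hx
    exact MemLp.integrable_sq (memLp_finsetSum _ fun i _ => hL2 x hx i)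
  · filter_upwards [hBD] with x hx
    have h1 := integral_sq_sum_sub_le (hY x) (hL2 x hx) (V := S / m) fun i => (hsq x hx i).2
    have h2 : ∀ i : Fin m, ∫ θ : Param m d, θ.a i * σ (inner ℝ (θ.w i) x) ∂(initMeasure m d) = 0 := by
      intro i
      have hind : IndepFun (fun θ : Param m d => θ.a i)
          (fun θ : Param m d => σ (inner ℝ (θ.w i) x)) (initMeasure m d) :=
        (indepFun_a_w i).comp measurable_id (hmeasσ x)
      rw [hind.integral_fun_mul_eq_mul_integral (measurable_a i).aestronglyMeasurable
        ((hmeasσ x).comp (measurable_w i)).aestronglyMeasurable, integral_a, zero_mul]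
    simp only [h2, Finset.sum_const_zero, sub_zero] at h1
    refine h1.trans_eq ?_
    field_simp
  · rw [div_mul_cancel₀ _ hδ.ne']
    linarith

end Events

/-! ### The gradient inequality near initialization. -/

section GradientLowerBound

variable {σ : ℝ → ℝ} {Lσ : ℝ≥0} {m d : ℕ} {D : Measure (Input d)} {K : Set (Input d)} {v : Input d}
  {f : Input d → ℝ}

theorem norm_sq_zero_withA (b : Fin m → ℝ) : ‖(0 : Param m d).withA b‖ ^ 2 = ∑ i, b i ^ 2 := by
  rw [Param.norm_sq]
  have h : ∀ i, (0 : Param m d).w i = 0 := fun i => by ext j; simp [Param.w]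
  simp [h]

/-- Only output weights differ, and `b - a = b - a₀ - (a - a₀)`. This is the source of the constant
`c`. -/
theorem norm_withA_sub_le {θ θ₀ : Param m d} {b : Fin m → ℝ} {A : ℝ}
    (hA : ∑ i, θ₀.a i ^ 2 ≤ A) (hb : ∑ i, b i ^ 2 ≤ 1) :
    ‖θ.withA b - θ‖ ≤ ‖θ - θ₀‖ + (√A + 1) := by
  have h1 : θ.withA b - θ = (0 : Param m d).withA b - (0 : Param m d).withA θ₀.a
      - (0 : Param m d).withA (θ - θ₀).a := by
    ext k
    cases k <;> simp [Param.withA, Param.a]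
  have h2 : ‖(0 : Param m d).withA b‖ ≤ 1 := by
    refine le_of_sq_le_sq ?_ zero_le_one
    rw [norm_sq_zero_withA]
    simpa using hb
  have h3 : ‖(0 : Param m d).withA θ₀.a‖ ≤ √A := by
    refine Real.le_sqrt_of_sq_le ?_
    rwa [norm_sq_zero_withA]
  have h4 : ‖(0 : Param m d).withA (θ - θ₀).a‖ ≤ ‖θ - θ₀‖ := by
    refine le_of_sq_le_sq ?_ (norm_nonneg _)
    rw [norm_sq_zero_withA, Param.norm_sq]
    have : 0 ≤ ∑ i, ‖(θ - θ₀).w i‖ ^ 2 := Finset.sum_nonneg fun _ _ => sq_nonneg _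
    linarith
  rw [h1]
  have h5 := norm_sub_le ((0 : Param m d).withA b - (0 : Param m d).withA θ₀.a)
    ((0 : Param m d).withA (θ - θ₀).a)
  have h6 := norm_sub_le ((0 : Param m d).withA b) ((0 : Param m d).withA θ₀.a)
  linarith

/-- By Cauchy–Schwarz the hidden displacements sum to at most `√m R`, against output weights of size
`G / m`. -/
theorem abs_network_withA_sub_le (hσ : LipschitzWith Lσ σ) (hm : 0 < m) {θ θ₀ : Param m d}
    {b : Fin m → ℝ} {G R B : ℝ} (hG : 0 ≤ G) (hb : ∀ i, |b i| ≤ G / m) (hR : ‖θ - θ₀‖ ≤ R)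
    {x : Input d} (hx : ‖x‖ ≤ B) :
    |network σ (θ.withA b) x - network σ (θ₀.withA b) x| ≤ G * Lσ * B * R / √m := by
  have hm' : (0 : ℝ) < m := by exact_mod_cast hm
  have hB : 0 ≤ B := (norm_nonneg _).trans hx
  have hsum : ∑ i, ‖(θ - θ₀).w i‖ ≤ √m * R := by
    refine le_trans ?_ (mul_le_mul_of_nonneg_left hR (Real.sqrt_nonneg _))
    refine le_of_sq_le_sq ?_ (by positivity)
    have h1 := sq_sum_le_card_mul_sum_sq (s := Finset.univ) (f := fun i => ‖(θ - θ₀).w i‖)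
    rw [Finset.card_univ, Fintype.card_fin] at h1
    rw [mul_pow, Real.sq_sqrt hm'.le, Param.norm_sq]
    refine h1.trans (mul_le_mul_of_nonneg_left ?_ hm'.le)
    have : 0 ≤ ∑ i, (θ - θ₀).a i ^ 2 := Finset.sum_nonneg fun _ _ => sq_nonneg _
    linarith
  simp only [network, Param.a_withA, Param.w_withA]
  rw [← Finset.sum_sub_distrib]
  calc |∑ i, (b i * σ (inner ℝ (θ.w i) x) - b i * σ (inner ℝ (θ₀.w i) x))|
      ≤ ∑ i, G / m * (Lσ * (‖(θ - θ₀).w i‖ * B)) := by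
        refine (Finset.abs_sum_le_sum_abs _ _).trans (Finset.sum_le_sum fun i _ => ?_)
        rw [← mul_sub, abs_mul]
        refine mul_le_mul (hb i) ((hσ.abs_sub_le _ _).trans ?_) (abs_nonneg _) (by positivity)
        rw [← inner_sub_left, ← Param.w_sub]
        gcongr
        exact (abs_real_inner_le_norm _ _).trans (by gcongr)
    _ = G / m * Lσ * B * ∑ i, ‖(θ - θ₀).w i‖ := by
        rw [Finset.mul_sum]
        exact Finset.sum_congr rfl fun i _ => by ring
    _ ≤ G / m * Lσ * B * (√m * R) := by gcongr
    _ = G * Lσ * B * R / √m := by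
        have : (m : ℝ) = √m * √m := (Real.mul_self_sqrt hm'.le).symm
        have h0 : √(m : ℝ) ≠ 0 := by positivity
        rw [show G / m * Lσ * B * (√m * R) = G * Lσ * B * R * (√m / m) by ring]
        conv_lhs => rw [show √(m : ℝ) / m = √m / (√m * √m) by rw [← this]]
        field_simp

theorem exists_gradient_lower_bound [IsProbabilityMeasure D] (hσ : LipschitzWith Lσ σ)
    (hpoly : ¬ ∃ p : Polynomial ℝ, ∀ s : ℝ, σ s = p.eval s) (hK : IsCompact K) (hD : D Kᶜ = 0)
    (hv : ∀ x ∈ K, inner ℝ v x = 1) (hf : Continuous f) {δ ε : ℝ} (hδ : 0 < δ) (hε : 0 < ε) :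
    ∃ c : ℝ, 0 < c ∧ ∀ R : ℝ, 0 < R → ∃ m₀ : ℕ, 0 < m₀ ∧ ∀ m : ℕ, m₀ ≤ m →
      WithProbAtLeast (initMeasure m d) (1 - δ) fun θ₀ =>
        ∀ θ ∈ Metric.closedBall θ₀ R, DifferentiableAt ℝ (loss σ D f m) θ →
          loss σ D f m θ - ε ≤ ‖∇ (loss σ D f m) θ‖ * (‖θ - θ₀‖ + c) := by
  obtain ⟨B, hB0, hBD⟩ := exists_ae_bound hK hD continuous_id
  simp only [id] at hBD
  obtain ⟨g, G, C, hg, hG, hC, happrox⟩ := exists_density_approx hK hD hv hσ hpoly hf hB0 hBD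
    (ε := ε / 16) (by positivity)
  have hG0 : 0 ≤ G := (abs_nonneg _).trans (hG 0)
  refine ⟨√(1 / (δ / 2)) + 1, by positivity, fun R hR => ?_⟩
  -- The three terms ensure, in order, `∑ b i ^ 2 ≤ 1`, the concentration of the sampled network,
  -- and its stability when the hidden weights move by `R`.
  obtain ⟨N, hN⟩ := exists_nat_ge (G ^ 2 + C ^ 2 / (ε / 16 * (δ / 2)) + 4 * (G * Lσ * B * R) ^ 2 / ε)
  refine ⟨N + 1, by simp, fun m hm => ?_⟩
  have hm0 : 0 < m := by omega
  have hm' : (0 : ℝ) < m := by exact_mod_cast hm0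
  have hNm : (N : ℝ) ≤ m := by exact_mod_cast (by omega : N ≤ m)
  have p1 : 0 ≤ G ^ 2 := sq_nonneg _
  have p2 : 0 ≤ C ^ 2 / (ε / 16 * (δ / 2)) := by positivity
  have p3 : 0 ≤ 4 * (G * Lσ * B * R) ^ 2 / ε := by positivity
  have hm1 : G ^ 2 ≤ m := by linarith
  have hm2 : C ^ 2 ≤ m * (ε / 16 * (δ / 2)) := by
    rw [← div_le_iff₀ (by positivity)]; linarith
  have hm3 : 4 * (G * Lσ * B * R) ^ 2 ≤ m * ε := by
    rw [← div_le_iff₀ hε]; linarith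
  have hev := (withProbAtLeast_sum_a_sq_le (d := d) (D := D) hm0 (half_pos hδ)).and
    (withProbAtLeast_average_le (D := D) hm0 hσ.continuous hg hBD hC (η := ε / 16)
      (by positivity) (half_pos hδ) hm2)
  rw [add_halves] at hev
  refine hev.mono fun θ₀ hθ₀ θ hθ hdiff => ?_
  obtain ⟨hA, havg⟩ := hθ₀
  set b : Fin m → ℝ := fun i => g (θ₀.w i) / m with hb
  have hbG : ∀ i, |b i| ≤ G / m := fun i => by
    simp only [hb]
    rw [abs_div, abs_of_pos hm']
    gcongr
    exact hG _
  have hbsum : ∑ i, b i ^ 2 ≤ 1 := by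
    calc ∑ i, b i ^ 2 ≤ ∑ _ : Fin m, (G / m) ^ 2 := Finset.sum_le_sum fun i _ => by
          rw [← sq_abs]
          exact pow_le_pow_left₀ (abs_nonneg _) (hbG i) 2
      _ = G ^ 2 / m := by
          simp only [Finset.sum_const, Finset.card_univ, Fintype.card_fin, nsmul_eq_mul]
          field_simp
      _ ≤ 1 := (div_le_one hm').2 hm1
  have hR' : ‖θ - θ₀‖ ≤ R := by rw [← dist_eq_norm]; exact hθ
  have hconv := loss_sub_loss_withA_le hσ.continuous hf hK hD hdiff b
  have hnorm := norm_withA_sub_le (θ := θ) hA hbsum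
  have hq := stronglyMeasurable_integral_activation hσ.continuous hg
  have hqL2 : MemLp (fun x : Input d => ∫ w, g w * σ (inner ℝ w x) ∂(stdGaussian (Input d))) 2 D := by
    refine MemLp.of_bound hq.aestronglyMeasurable C ?_
    filter_upwards [hBD] with x hx
    have h := norm_integral_le_of_norm_le_const (μ := stdGaussian (Input d))
      (f := fun w => g w * σ (inner ℝ w x)) (Filter.Eventually.of_forall fun w => hC x hx w)
    simpa using h
  have hfL2 : MemLp f 2 D := memLp_of_continuous hK hD hf
  have hnetL2 : MemLp (network σ (θ₀.withA b)) 2 D := memLp_of_continuous hK hD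
    ((continuous_network hσ.continuous).comp (Continuous.prodMk_right (θ₀.withA b)))
  -- Error budget: sampling and approximation cost `2 · ε/16` each, giving `ε/4`; the displacement
  -- adds as much, and doubling both yields `ε`.
  have hl0 : loss σ D f m (θ₀.withA b) ≤ ε / 4 := by
    have h := sqSeminorm_sub_le (hnetL2.sub hqL2).integrable_sq (hqL2.sub hfL2).integrable_sq
    unfold loss
    linarith
  have hl1 : loss σ D f m (θ.withA b) ≤ ε := by
    have h := sqSeminorm_sub_le_of_ae_abs_sub_le (f := f) (p := network σ (θ.withA b))
      (q := network σ (θ₀.withA b)) (τ := G * Lσ * B * R / √m)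
      (by filter_upwards [hBD] with x hx using abs_network_withA_sub_le hσ hm0 hG0 hbG hR' hx)
      (hnetL2.sub hfL2).integrable_sq
    have h2 : (G * Lσ * B * R / √m) ^ 2 ≤ ε / 4 := by
      rw [div_pow, Real.sq_sqrt hm'.le, div_le_iff₀ hm']
      linarith
    unfold loss at hl0 ⊢
    linarith
  have := mul_le_mul_of_nonneg_left hnorm (norm_nonneg (∇ (loss σ D f m) θ))
  linarith

theorem exists_withProbAtLeast_loss_le [IsProbabilityMeasure D] (hσ : LipschitzWith Lσ σ)
    (hK : IsCompact K) (hD : D Kᶜ = 0) (hf : Continuous f) {δ : ℝ} (hδ : 0 < δ) :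
    ∃ M : ℝ, 0 < M ∧ ∀ m : ℕ, 0 < m → WithProbAtLeast (initMeasure m d) (1 - δ) fun θ =>
      loss σ D f m θ ≤ M := by
  obtain ⟨B, -, hBD⟩ := exists_ae_bound hK hD continuous_id
  obtain ⟨M, hM⟩ := exists_withProbAtLeast_network_le hσ hBD hδ
  have hfL2 : MemLp f 2 D := memLp_of_continuous hK hD hf
  refine ⟨max 1 (2 * M + 2 * sqSeminorm D fun x => 0 - f x), by positivity, fun m hm => ?_⟩
  refine (hM m hm).mono fun θ hθ => le_max_of_le_right ?_
  have hnetL2 : MemLp (network σ θ) 2 D := memLp_of_continuous hK hD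
    ((continuous_network hσ.continuous).comp (Continuous.prodMk_right θ))
  have h := sqSeminorm_sub_le (f := f) (p := network σ θ) (q := fun _ => 0) (D := D)
    (by simpa using hnetL2.integrable_sq) (by simpa using hfL2.integrable_sq)
  simp only [sub_zero] at h
  unfold loss
  linarith

end GradientLowerBound

end TwoLayer

/-! ### The proposition. -/

theorem proposition4p6 {d : ℕ}
    -- a non-polynomial Lipschitz activation
    (σ : ℝ → ℝ) (Lσ : ℝ≥0) (hσ : LipschitzWith Lσ σ)
    (hσ_poly : ¬ ∃ p : Polynomial ℝ, ∀ s : ℝ, σ s = p.eval s)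
    -- a data distribution supported on a compact set
    (K : Set (TwoLayer.Input d)) (hK : IsCompact K)
    (D : Measure (TwoLayer.Input d)) [IsProbabilityMeasure D] (hD : D Kᶜ = 0)
    -- the bias is carried by the input: some linear form is a non-zero constant on `K`
    (v : TwoLayer.Input d) (hv : ∀ x ∈ K, inner ℝ v x = 1)
    -- a continuous target
    (f : TwoLayer.Input d → ℝ) (hf : Continuous f)
    (δ : ℝ) (hδ0 : 0 < δ) (hδ1 : δ < 1) :
    -- the loss is differentiable as soon as the activation is
    (Differentiable ℝ σ → ∀ m : ℕ, Differentiable ℝ (TwoLayer.loss σ D f m)) ∧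
    -- the inequality on a ball around the initialization
    (∀ ε : ℝ, 0 < ε → ∃ c : ℝ, 0 < c ∧ ∀ R : ℝ, 0 < R → ∃ m₀ : ℕ, ∀ m : ℕ, m₀ ≤ m →
      TwoLayer.WithProbAtLeast (TwoLayer.initMeasure m d) (1 - δ) fun θ₀ =>
        ∀ θ ∈ Metric.closedBall θ₀ R, DifferentiableAt ℝ (TwoLayer.loss σ D f m) θ →
          ‖∇ (TwoLayer.loss σ D f m) θ‖ ^ 2 ≥
            1 / (‖θ - θ₀‖ + c) ^ 2 * max 0 (TwoLayer.loss σ D f m θ - ε) ^ 2) ∧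
    -- the convergence rate of gradient flows
    (∀ ε₀ : ℝ, 0 < ε₀ → ∃ κ : ℝ, 0 < κ ∧ ∃ m₀ : ℕ, ∀ m : ℕ, m₀ ≤ m →
      TwoLayer.WithProbAtLeast (TwoLayer.initMeasure m d) (1 - δ) fun θ₀ =>
        ∀ θ : ℝ → TwoLayer.Param m d,
          TwoLayer.IsGradientFlow (TwoLayer.loss σ D f m) θ → θ 0 = θ₀ →
            ∀ t : ℝ, 0 ≤ t → TwoLayer.loss σ D f m (θ t) ≤
              ε₀ + 1 / ((TwoLayer.loss σ D f m θ₀) ^ (-3 : ℤ) + κ * t) ^ (1 / 3 : ℝ)) := by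
  refine ⟨fun hd m => TwoLayer.differentiable_loss hσ hd hf hK hD m, fun ε hε => ?_,
    fun ε₀ hε₀ => ?_⟩
  · obtain ⟨c, hc, h⟩ := TwoLayer.exists_gradient_lower_bound hσ hσ_poly hK hD hv hf hδ0 hε
    refine ⟨c, hc, fun R hR => ?_⟩
    obtain ⟨m₀, -, hm₀⟩ := h R hR
    refine ⟨m₀, fun m hm => (hm₀ m hm).mono fun θ₀ hθ₀ θ hθ hdiff => ?_⟩
    have h1 := hθ₀ θ hθ hdiff
    have hpos : 0 < ‖θ - θ₀‖ + c := by positivity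
    have h2 : max 0 (TwoLayer.loss σ D f m θ - ε)
        ≤ ‖∇ (TwoLayer.loss σ D f m) θ‖ * (‖θ - θ₀‖ + c) := max_le (by positivity) h1
    rw [ge_iff_le, one_div_mul_eq_div, div_le_iff₀ (by positivity), ← mul_pow]
    exact pow_le_pow_left₀ (le_max_left _ _) h2 2
  · obtain ⟨c, hc, h⟩ := TwoLayer.exists_gradient_lower_bound hσ hσ_poly hK hD hv hf
      (half_pos hδ0) (half_pos hε₀)
    obtain ⟨M, hM, hM'⟩ := TwoLayer.exists_withProbAtLeast_loss_le hσ hK hD hf (half_pos hδ0)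
    -- Neither `c` nor `M` depends on `m`, so the confinement radius of the flow is available before
    -- the width threshold is chosen. Each of the two events may fail with probability `δ / 2`.
    obtain ⟨m₀, hm₀, h'⟩ := h (c * M / (ε₀ / 2)) (by positivity)
    refine ⟨3 / (c * M) ^ 2, by positivity, m₀, fun m hm => ?_⟩
    have hev := (h' m hm).and (hM' m (hm₀.trans_le hm))
    rw [add_halves] at hev
    refine hev.mono fun θ₀ hθ₀ θ hflow h0 t ht => ?_
    subst h0
    have key := hflow.loss_le (TwoLayer.locallyLipschitz_loss hσ hf hK hD m)
      TwoLayer.loss_nonneg (half_pos hε₀) hc hθ₀.2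
      (fun x hx hdiff => by rw [dist_eq_norm]; exact hθ₀.1 x hx hdiff) ht
    rwa [mul_div_cancel₀ ε₀ two_ne_zero] at key
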